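/- **Setting.** Let $\mathbb K=\mathbb R$ or $\mathbb C$, let $n,m\ge 1$, and let $\mathcal X^1,\dots,\mathcal X^n,\mathcal Y^1,\dots,\mathcal Y^m:\mathbb K^{n+m}\to\mathbb K$ be $C^\infty$-smooth functions of $(x,y)=(x^1,\dots,x^n,y^1,\dots,y^m)$. The $\kappa$-th jet space $\mathcal J^\kappa_{n,m}$ has the coordinates $x^i$, $y^j$ and $y^j_{i_1,\dots,i_\lambda}$ ($1\le\lambda\le\kappa$), the latter being symmetric in the lower indices and otherwise independent. For a function $f$ on $\mathcal J^{\lambda-1}_{n,m}$ let $$D^\lambda_i f=\frac{\partial f}{\partial x^i}+\sum_{j=1}^m y^j_i\frac{\partial f}{\partial y^j}+\sum_{j=1}^m\sum_{r=1}^{\lambda-1}\ \sum_{\{i_1,\dots,i_r\}} y^j_{i,i_1,\dots,i_r}\frac{\partial f}{\partial y^j_{i_1,\dots,i_r}},$$ a function on $\mathcal J^\lambda_{n,m}$, where the inner sum runs over the multisets $\{i_1,\dots,i_r\}$ of elements of $\{1,\dots,n\}$ (each jet coordinate contributes once). The coefficients $\mathbf Y^j_{i_1,\dots,i_\kappa}$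 of the $\kappa$-th prolongation of the vector field $\sum_i\mathcal X^i\,\partial_{x^i}+\sum_j\mathcal Y^j\,\partial_{y^j}$ are the functions on $\mathcal J^\kappa_{n,m}$ given by Lie's inductive formulas $$\mathbf Y^j_{i_1}=D^1_{i_1}(\mathcal Y^j)-\sum_{k=1}^nD^1_{i_1}(\mathcal X^k)\,y^j_k,\qquad \mathbf Y^j_{i_1,\dots,i_\kappa}=D^\kappa_{i_\kappa}\big(\mathbf Y^j_{i_1,\dots,i_{\kappa-1}}\big)-\sum_{k=1}^nD^1_{i_\kappa}(\mathcal X^k)\,y^j_{i_1,\dots,i_{\kappa-1},k}.$$ **Combinatorial notation.** Given $1\le\lambda_1<\dots<\lambda_d$ and $\mu_1,\dots,\mu_d\ge1$, put $N=\mu_1\lambda_1+\dots+\mu_d\lambda_d$ and $M=\mu_1+\dots+\mu_d$. The set $P$ of the labels $e\!:\!\nu\!:\!\gamma$ with $1\le e\le d$, $1\le\nu\le\mu_e$, $1\le\gamma\le\lambda_e$ is identified with $\{1,\dots,N\}$ by the lexicographic order, so that the last label is $d\!:\!\mu_d\!:\!\lambda_d$; put $\pi(e\!:\!\nu\!:\!\gamma)=e\!:\!\nu$.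 Let $\mathfrak H$ be the group of the permutations $\sigma$ of $P$ with $$\prod_{e,\nu}y_{k_{\sigma(e:\nu:1)},\dots,k_{\sigma(e:\nu:\lambda_e)}}=\prod_{e,\nu}y_{k_{e:\nu:1},\dots,k_{e:\nu:\lambda_e}}$$ as monomials in symbols $y$ with symmetric lower indices, for arbitrary indices $k$. Let $\mathfrak F$ be any set of representatives of the classes $\mathfrak H\sigma$ of permutations $\sigma$ of $P$, where $(h\sigma)(p)=h(\sigma(p))$. For $0\le q\le\kappa$ let $\mathfrak S_\kappa^q$ be the set of the permutations $\tau$ of $\{1,\dots,\kappa\}$ with $\tau(1)<\dots<\tau(q)$ and $\tau(q+1)<\dots<\tau(\kappa)$, and let $\mathfrak S_\kappa^{\kappa+1}=\emptyset$. Finally $\delta^{k_1,\dots,k_q}_{i_1,\dots,i_q}=\delta^{k_1}_{i_1}\cdots\delta^{k_q}_{i_q}$ is a product of Kronecker symbols, equal to $1$ if $q=0$. **Theorem 5.12.** For $j=1,\dots,m$, for every $\kappa\ge1$, for all $i_1,\dots,i_\kappa\in\{1,\dots,n\}$ and for every choice of the sets of representatives $\mathfrak F=\mathfrak F^{(\mu_1,\lambda_1),\dots,(\mu_d,\lambda_d)}_N$,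 $$\mathbf Y^j_{i_1,\dots,i_\kappa}=\frac{\partial^\kappa\mathcal Y^j}{\partial x^{i_1}\cdots\partial x^{i_\kappa}}+\sum_{d=1}^{\kappa+1}\ \sum_{1\le\lambda_1<\dots<\lambda_d\le\kappa}\ \sum_{\substack{\mu_1,\dots,\mu_d\ge1\\ \mu_1\lambda_1+\dots+\mu_d\lambda_d\le\kappa+1}}\ \sum_{l}\ \sum_{k}\ \big[A-B\big]\prod_{e=1}^d\prod_{\nu=1}^{\mu_e}y^{l_{e:\nu}}_{k_{e:\nu:1},\dots,k_{e:\nu:\lambda_e}},$$ where $l=(l_{e:\nu})$ runs over all families in $\{1,\dots,m\}$, $k=(k_{e:\nu:\gamma})$ runs over all families in $\{1,\dots,n\}$, and $$A=\sum_{\sigma\in\mathfrak F}\ \sum_{\tau\in\mathfrak S_\kappa^{N}}\delta^{k_{\sigma(1:1:1)},\dots,k_{\sigma(d:\mu_d:\lambda_d)}}_{i_{\tau(1)},\dots,i_{\tau(N)}}\ \frac{\partial^{\kappa-N+M}\mathcal Y^j}{\partial x^{i_{\tau(N+1)}}\cdots\partial x^{i_{\tau(\kappa)}}\,\partial y^{l_{1:1}}\cdots\partial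 y^{l_{d:\mu_d}}},$$ $$B=\sum_{\sigma\in\mathfrak F}\ \sum_{\tau\in\mathfrak S_\kappa^{N-1}}\delta^{k_{\sigma(1:1:1)},\dots,k_{\sigma(d:\mu_d:\lambda_d-1)}}_{i_{\tau(1)},\dots,i_{\tau(N-1)}}\ \delta^j_{l_{\pi\sigma(d:\mu_d:\lambda_d)}}\ \frac{\partial^{\kappa-N+M}\mathcal X^{k_{\sigma(d:\mu_d:\lambda_d)}}}{\partial x^{i_{\tau(N)}}\cdots\partial x^{i_{\tau(\kappa)}}\,\partial y^{l_{1:1}}\cdots\widehat{\partial y^{l_{\pi\sigma(d:\mu_d:\lambda_d)}}}\cdots\partial y^{l_{d:\mu_d}}}.$$ In $A$ and $B$ the upper indices of the first Kronecker symbol are the $k_{\sigma(p)}$, where $p$ runs in lexicographic order through all the labels in $A$ and through the first $N-1$ labels in $B$; the hat means that this one derivative is dropped. -/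

import Mathlib

open scoped ContDiff

namespace LieProlongation

noncomputable section

/-! ### Jet spaces -/

/-- Unordered tuples (multisets) of at most `κ` indices in `Fin n`. The pure jet coordinate
`y^j_{i_1, …, i_r}` is symmetric in its lower indices, hence is labelled by the multiset
`{i_1, …, i_r}`. -/
abbrev MultiIdx (n κ : ℕ) : Type := {s : Multiset (Fin n) // Multiset.card s ≤ κ}

instance (n κ : ℕ) : Finite (MultiIdx n κ) := by
  refine Finite.of_injective
    (fun s : MultiIdx n κ => fun a : Fin n =>
      (⟨Multiset.count a s.1, Nat.lt_succ_of_le ((Multiset.count_le_card a s.1).trans s.2)⟩ :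
        Fin (κ + 1))) ?_
  intro s t h
  refine Subtype.ext (Multiset.ext.2 fun a => ?_)
  exact congrArg Fin.val (congrFun h a)

instance (n κ : ℕ) : Fintype (MultiIdx n κ) := Fintype.ofFinite _

/-- The multiset of the values of a tuple. -/
def multiset {α ι : Type*} [Fintype α] (k : α → ι) : Multiset ι :=
  (Finset.univ : Finset α).val.map k

theorem card_multiset {α ι : Type*} [Fintype α] (k : α → ι) :
    Multiset.card (multiset k) = Fintype.card α := by
  simp [multiset]

/-- The labels of the coordinates of the `κ`-th jet space: `Sum.inl i` is `x^i`, and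
`Sum.inr (j, {i_1, …, i_r})` with `r ≤ κ` is `y^j_{i_1, …, i_r}` (it is `y^j` if `r = 0`). -/
abbrev JetCoord (n m κ : ℕ) : Type := Fin n ⊕ (Fin m × MultiIdx n κ)

/-- The `κ`-th jet space, for `n` independent and `m` dependent variables. -/
abbrev Jet (𝕜 : Type*) (n m κ : ℕ) : Type _ := JetCoord n m κ → 𝕜

/-- The affine space `𝕜^{n+m}`, with coordinates `x^i` (`Sum.inl i`) and `y^j` (`Sum.inr j`). -/
abbrev Base (𝕜 : Type*) (n m : ℕ) : Type _ := Fin n ⊕ Fin m → 𝕜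

/-- The canonical projection from the `κ`-th to the `κ'`-th jet space, `κ' ≤ κ`. -/
def Jet.proj {𝕜 : Type*} {n m κ κ' : ℕ} (h : κ' ≤ κ) (z : Jet 𝕜 n m κ) : Jet 𝕜 n m κ' :=
  Sum.elim (fun i => z (Sum.inl i)) (fun js => z (Sum.inr (js.1, ⟨js.2.1, js.2.2.trans h⟩)))

/-- The point `(x, y)` over which a jet lies. -/
def Jet.base {𝕜 : Type*} {n m κ : ℕ} (z : Jet 𝕜 n m κ) : Base 𝕜 n m :=
  Sum.elim (fun i => z (Sum.inl i)) (fun j => z (Sum.inr (j, ⟨0, Nat.zero_le κ⟩)))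

/-- The jet coordinate `y^j_{k_1, …, k_r}`, the lower indices being a tuple of length `r ≤ κ`
indexed by `α`. -/
def Jet.y {𝕜 : Type*} {n m κ : ℕ} (z : Jet 𝕜 n m κ) (j : Fin m) {α : Type*} [Fintype α]
    (k : α → Fin n) (h : Fintype.card α ≤ κ) : 𝕜 :=
  z (Sum.inr (j, ⟨multiset k, (card_multiset k).trans_le h⟩))

/-! ### Partial derivatives, total derivatives and prolongation -/

section Derivatives

variable {𝕜 : Type*} [RCLike 𝕜]

/-- The partial derivative with respect to the coordinate `c`. -/
def pd {ι : Type*} [Fintype ι] [DecidableEq ι] (c : ι) (f : (ι → 𝕜) → 𝕜) : (ι → 𝕜) → 𝕜 :=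
  fun p => fderiv 𝕜 f p (Pi.single c 1)

/-- The iterated partial derivative with respect to all the coordinates in a list. -/
def iterPd {ι : Type*} [Fintype ι] [DecidableEq ι] (L : List ι) (f : (ι → 𝕜) → 𝕜) :
    (ι → 𝕜) → 𝕜 :=
  L.foldr pd f

/-- The partial derivative of a function of `(x, y)` with respect to the variables `x^i`, `i` in
the list `xs`, and `y^l`, `l` in the list `ys`. -/
def mixedPd {n m : ℕ} (xs : List (Fin n)) (ys : List (Fin m)) (f : Base 𝕜 n m → 𝕜) :
    Base 𝕜 n m → 𝕜 :=
  iterPd (xs.map Sum.inl ++ ys.map Sum.inr) f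

/-- The `i`-th total differentiation operator of order `κ + 1`, from functions on the `κ`-th to
functions on the `(κ + 1)`-st jet space:
`∂/∂x^i + ∑_j y^j_i ∂/∂y^j + ⋯ + ∑_j ∑ y^j_{i, i_1, …, i_κ} ∂/∂y^j_{i_1, …, i_κ}`.
Every coordinate `y^j_{i_1, …, i_r}`, `r ≤ κ`, of the `κ`-th jet space contributes one term. -/
def totalDeriv {n m : ℕ} (κ : ℕ) (i : Fin n) (f : Jet 𝕜 n m κ → 𝕜) : Jet 𝕜 n m (κ + 1) → 𝕜 :=
  fun z =>
    pd (Sum.inl i) f (z.proj (Nat.le_succ κ)) +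
      ∑ j : Fin m, ∑ s : MultiIdx n κ,
        z (Sum.inr (j, ⟨i ::ₘ s.1, (Multiset.card_cons i s.1).trans_le (Nat.succ_le_succ s.2)⟩)) *
          pd (Sum.inr (j, s)) f (z.proj (Nat.le_succ κ))

/-- The coefficient `𝐘^j_{i_1, …, i_κ}` of the prolongation to the jet spaces of the vector field
`∑_i X^i ∂/∂x^i + ∑_j Y^j ∂/∂y^j`, defined by Lie's inductive formulas:
`𝐘^j_∅ = Y^j` and
`𝐘^j_{i_1, …, i_{κ+1}} = D_{i_{κ+1}}(𝐘^j_{i_1, …, i_κ})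
  - ∑_k D_{i_{κ+1}}(X^k) y^j_{i_1, …, i_κ, k}`. -/
def prolongCoeff {n m : ℕ} (X : Fin n → Base 𝕜 n m → 𝕜) (Y : Fin m → Base 𝕜 n m → 𝕜)
    (j : Fin m) : (κ : ℕ) → (Fin κ → Fin n) → Jet 𝕜 n m κ → 𝕜
  | 0, _ => fun z => Y j z.base
  | κ + 1, i => fun z =>
      totalDeriv κ (i (Fin.last κ)) (prolongCoeff X Y j κ (fun a => i a.castSucc)) z -
        ∑ k : Fin n,
          totalDeriv 0 (i (Fin.last κ)) (fun w : Jet 𝕜 n m 0 => X k w.base)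
              (z.proj (Nat.succ_le_succ (Nat.zero_le κ))) *
            z.y j (Fin.snoc (α := fun _ => Fin n) (fun a => i a.castSucc) k)
              (Fintype.card_fin (κ + 1)).le

end Derivatives

/-! ### The combinatorial data -/

/-- Integers `1 ≤ λ_1 < ⋯ < λ_d ≤ κ` (`len`) and `μ_1 ≥ 1, …, μ_d ≥ 1` (`mult`) with
`μ_1 λ_1 + ⋯ + μ_d λ_d ≤ κ + 1`, where `d ≥ 1`. -/
@[ext]
structure Shape (κ d : ℕ) where
  len : Fin d → ℕ
  mult : Fin d → ℕ
  one_le_d : 1 ≤ d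
  one_le_len : ∀ e, 1 ≤ len e
  strictMono_len : StrictMono len
  len_le : ∀ e, len e ≤ κ
  one_le_mult : ∀ e, 1 ≤ mult e
  sum_le : ∑ e, mult e * len e ≤ κ + 1

namespace Shape

variable {κ d : ℕ}

theorem mult_le (s : Shape κ d) (e : Fin d) : s.mult e ≤ κ + 1 :=
  (Nat.le_mul_of_pos_right _ (s.one_le_len e)).trans
    ((Finset.single_le_sum (f := fun e => s.mult e * s.len e) (fun _ _ => Nat.zero_le _)
      (Finset.mem_univ e)).trans s.sum_le)

instance : Finite (Shape κ d) := by
  refine Finite.of_injective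
    (fun s : Shape κ d => fun e : Fin d =>
      ((⟨s.len e, Nat.lt_succ_of_le (s.len_le e)⟩ : Fin (κ + 1)),
        (⟨s.mult e, Nat.lt_succ_of_le (s.mult_le e)⟩ : Fin (κ + 2)))) ?_
  intro s t h
  refine Shape.ext (funext fun e => ?_) (funext fun e => ?_)
  · exact congrArg (fun q => q.1.val) (congrFun h e)
  · exact congrArg (fun q => q.2.val) (congrFun h e)

instance : Fintype (Shape κ d) := Fintype.ofFinite _

/-- The total weight `μ_1 λ_1 + ⋯ + μ_d λ_d`. -/
def weight (s : Shape κ d) : ℕ := ∑ e, s.mult e * s.len e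

theorem weight_pos (s : Shape κ d) : 0 < s.weight :=
  Finset.sum_pos (fun e _ => Nat.mul_pos (s.one_le_mult e) (s.one_le_len e))
    ⟨⟨0, s.one_le_d⟩, Finset.mem_univ _⟩

/-- The labels `e : ν` of the factors of the jet monomial, `1 ≤ ν ≤ μ_e`. -/
abbrev Block (s : Shape κ d) : Type := Σ e : Fin d, Fin (s.mult e)

/-- The labels `e : ν : γ` of the lower indices in the jet monomial, `1 ≤ ν ≤ μ_e` and
`1 ≤ γ ≤ λ_e`. -/
abbrev Pos (s : Shape κ d) : Type := Σ e : Fin d, Fin (s.mult e) × Fin (s.len e)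

/-- The projection `e : ν : γ ↦ e : ν`. -/
def toBlock (s : Shape κ d) (p : s.Pos) : s.Block := ⟨p.1, p.2.1⟩

/-- The label `e : ν : γ`, for `b = e : ν`. -/
def pos (s : Shape κ d) (b : s.Block) (γ : Fin (s.len b.1)) : s.Pos := ⟨b.1, b.2, γ⟩

/-- The labels `1:1, …, 1:μ_1, …, d:1, …, d:μ_d`, listed in lexicographic order. -/
def blocks (s : Shape κ d) : List s.Block :=
  (List.finRange d).flatMap fun e => (List.finRange (s.mult e)).map fun ν => ⟨e, ν⟩

/-- The lexicographic identification of the labels `e : ν : γ` with the numbers from `1` to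
`μ_1 λ_1 + ⋯ + μ_d λ_d` (here: from `0` to `weight - 1`). -/
def enum (s : Shape κ d) : s.Pos ≃ Fin s.weight :=
  (Equiv.sigmaCongrRight fun e : Fin d =>
    (finProdFinEquiv : Fin (s.mult e) × Fin (s.len e) ≃ Fin (s.mult e * s.len e))).trans
    finSigmaFinEquiv

/-- The last label `d : μ_d : λ_d`. -/
def last (s : Shape κ d) : s.Pos :=
  s.enum.symm ⟨s.weight - 1, Nat.sub_lt s.weight_pos Nat.one_pos⟩

/-- The commutative monomial `∏_{e, ν} y_{k_{e:ν:1}, …, k_{e:ν:λ_e}}` in symbols `y` with symmetric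
lower indices, as the multiset of its factors, each factor being the multiset of its indices. -/
def monomial (s : Shape κ d) (k : s.Pos → ℕ) : Multiset (Multiset ℕ) :=
  multiset fun b : s.Block => multiset fun γ : Fin (s.len b.1) => k (s.pos b γ)

/-- The group of the permutations `σ` of the labels that leave the general jet monomial unchanged:
`∏ y_{k_{σ(e:ν:1)}, …, k_{σ(e:ν:λ_e)}} = ∏ y_{k_{e:ν:1}, …, k_{e:ν:λ_e}}` for arbitrary indices. -/
def stabilizer (s : Shape κ d) : Subgroup (Equiv.Perm s.Pos) where
  carrier := {σ | ∀ k : s.Pos → ℕ, s.monomial (fun p => k (σ p)) = s.monomial k}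
  mul_mem' := fun {σ τ} hσ hτ k => (hτ fun p => k (σ p)).trans (hσ k)
  one_mem' := fun _ => rfl
  inv_mem' := fun {σ} hσ k => by
    have h := hσ fun p => k (σ⁻¹ p)
    simpa using h.symm

end Shape

/-- The permutations `τ` of `p` letters with `τ(1) < ⋯ < τ(q)` and `τ(q+1) < ⋯ < τ(p)`. There are
none if `q > p`; for `q = 0` and for `q = p` there is only the identity. -/
@[ext]
structure Shuffle (p q : ℕ) where
  perm : Equiv.Perm (Fin p)
  le : q ≤ p
  head : StrictMonoOn perm {a | a.val < q}
  tail : StrictMonoOn perm {a | q ≤ a.val}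

instance (p q : ℕ) : Finite (Shuffle p q) :=
  Finite.of_injective Shuffle.perm fun _ _ h => Shuffle.ext h

instance (p q : ℕ) : Fintype (Shuffle p q) := Fintype.ofFinite _

/-- The list `i_{τ(q+1)}, …, i_{τ(p)}`. -/
def Shuffle.rest {p q : ℕ} (τ : Shuffle p q) {α : Type*} (i : Fin p → α) : List α :=
  ((List.finRange p).filter fun a => decide (q ≤ a.val)).map fun a => i (τ.perm a)

/-- The multiple Kronecker symbol `δ^{k_1, …, k_q}_{i_1, …, i_q} = δ^{k_1}_{i_1} ⋯ δ^{k_q}_{i_q}`. -/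
def kron (𝕜 : Type*) [RCLike 𝕜] {q : ℕ} {α : Type*} [DecidableEq α] (k i : Fin q → α) : 𝕜 :=
  ∏ a : Fin q, if k a = i a then 1 else 0

end

end LieProlongation

open LieProlongation

open scoped ContDiff
open LieProlongation

/-! The formula is a count of set partitions. Let S be the set of the κ positions. In a jet
coordinate or derivative, position `a` stands for the index `i a`.

Expanding the iterated total derivative D_S f gives one term for each family Q of disjoint nonempty
blocks in S. A position outside all blocks contributes ∂/∂x, and a block B contributes ∑_l y^l_B
∂/∂y^l. One more total derivative with index `a` leaves `a` uncovered, opens the block {a}, or adds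
`a` to an existing block. This matches the recursion for such families (`sum_subpartitions_insert`,
`HasTotalDeriv.iterTotalDeriv`).

Lie's recursion solves to 𝐘^j_S = D_S Y^j − ∑_{U ⊊ S} ∑_k y^j_{k,U} D_{S∖U} X^k (`prolongCoeff_eq`).
The Leibniz rule yields the subsets with and without the new position, and Lie's correction term is
the missing case U = S.

To treat both halves alike, a marker `Fin.last κ` is adjoined to S. Families avoiding the marker
index D_S Y^j. A family covering it, with block U ∪ {marker}, encodes a term of the second sum; U is
proper exactly when this block has at most κ elements.

Finally the families are sorted by their multiset of block sizes, which is the data of a `Shape`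
(`sum_shapes`). A family of given shape is an injective labelling of its support by the labels
e:ν:γ, modulo the stabilizer of the monomial. The shuffle τ chooses the support and σ ∈ F chooses
the class (`Shape.sum_representatives`). The Kronecker symbols collapse the sums over k to the
indices prescribed by that labelling (`sum_unmarked`, `sum_marked`). -/

namespace LieProlongation

noncomputable section

/-! ### Iterated partial derivatives and polynomial symbols -/

section PartialDerivatives

variable {𝕜 ι : Type*} [RCLike 𝕜] [Fintype ι] [DecidableEq ι] {f : (ι → 𝕜) → 𝕜}

theorem contDiff_pd (hf : ContDiff 𝕜 ∞ f) (c : ι) : ContDiff 𝕜 ∞ (pd c f) :=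
  (hf.fderiv_right (m := ∞) (by simp)).clm_apply contDiff_const

theorem pd_comm (hf : ContDiff 𝕜 ∞ f) (c d : ι) : pd c (pd d f) = pd d (pd c f) := by
  have key : ∀ (c d : ι) (p : ι → 𝕜),
      pd c (pd d f) p = fderiv 𝕜 (fderiv 𝕜 f) p (Pi.single c 1) (Pi.single d 1) := by
    intro c d p
    have h : DifferentiableAt 𝕜 (fderiv 𝕜 f) p :=
      ((hf.fderiv_right (m := ∞) (by simp)).differentiable (by simp)) p
    change fderiv 𝕜 (fun p => fderiv 𝕜 f p (Pi.single d 1)) p (Pi.single c 1) = _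
    rw [fderiv_clm_apply h (differentiableAt_const _)]
    simp
  funext p
  rw [key, key]
  exact (hf.contDiffAt.isSymmSndFDerivAt (by
    rw [minSmoothness_of_isRCLikeNormedField]; exact WithTop.coe_le_coe.2 le_top)).eq _ _

theorem contDiff_iterPd (hf : ContDiff 𝕜 ∞ f) (L : List ι) : ContDiff 𝕜 ∞ (iterPd L f) := by
  induction L with
  | nil => exact hf
  | cons c L ih => exact contDiff_pd ih c

theorem iterPd_perm (hf : ContDiff 𝕜 ∞ f) {L L' : List ι} (h : L.Perm L') :
    iterPd L f = iterPd L' f := by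
  induction h with
  | nil => rfl
  | cons c _ ih => exact congrArg (pd c) ih
  | swap c d L => exact pd_comm (contDiff_iterPd hf L) d c
  | trans _ _ ih ih' => exact ih.trans ih'

theorem iterPd_concat (L : List ι) (c : ι) : iterPd (L ++ [c]) f = iterPd L (pd c f) := by
  simp [iterPd]

/-- The value at `p` of the constant coefficient differential operator with symbol `P`,
applied to `f`. -/
def symbolPd (f : (ι → 𝕜) → 𝕜) (p : ι → 𝕜) : MvPolynomial ι 𝕜 →ₗ[𝕜] 𝕜 :=
  (MvPolynomial.basisMonomials ι 𝕜).constr 𝕜 fun s => iterPd (Finsupp.toMultiset s).toList f p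

theorem symbolPd_monomial (f : (ι → 𝕜) → 𝕜) (p : ι → 𝕜) (s : ι →₀ ℕ) :
    symbolPd f p (MvPolynomial.monomial s 1) = iterPd (Finsupp.toMultiset s).toList f p := by
  have := (MvPolynomial.basisMonomials ι 𝕜).constr_basis 𝕜
    (fun s => iterPd (Finsupp.toMultiset s).toList f p) s
  rwa [MvPolynomial.coe_basisMonomials] at this

omit [Fintype ι] in
theorem prod_map_X (L : List ι) :
    (L.map (MvPolynomial.X : ι → MvPolynomial ι 𝕜)).prod =
      MvPolynomial.monomial (Multiset.toFinsupp (L : Multiset ι)) 1 := by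
  induction L with
  | nil => simp
  | cons c L ih =>
    rw [List.map_cons, List.prod_cons, ih, ← Multiset.cons_coe, ← Multiset.singleton_add, map_add,
      Multiset.toFinsupp_singleton, MvPolynomial.X, MvPolynomial.monomial_mul, one_mul]

theorem symbolPd_prod_X (hf : ContDiff 𝕜 ∞ f) (p : ι → 𝕜) (L : List ι) :
    symbolPd f p ((L.map MvPolynomial.X).prod) = iterPd L f p := by
  rw [prod_map_X, symbolPd_monomial]
  refine congrFun (iterPd_perm hf ?_) p
  rw [← Multiset.coe_eq_coe, Multiset.coe_toList, Multiset.toFinsupp_toMultiset]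

/-- Each basis monomial is evaluated in some chosen order of differentiation. Smoothness makes the
order irrelevant, so the new derivative may be applied first. Identities between operators thereby
become identities in a commutative polynomial ring. -/
theorem symbolPd_X_mul (hf : ContDiff 𝕜 ∞ f) (p : ι → 𝕜) (c : ι) (P : MvPolynomial ι 𝕜) :
    symbolPd f p (MvPolynomial.X c * P) = symbolPd (pd c f) p P := by
  suffices h : symbolPd f p ∘ₗ LinearMap.mulLeft 𝕜 (MvPolynomial.X c) = symbolPd (pd c f) p from
    LinearMap.congr_fun h P
  refine (MvPolynomial.basisMonomials ι 𝕜).ext fun s => ?_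
  have hs : (MvPolynomial.monomial s (1 : 𝕜)) =
      ((Finsupp.toMultiset s).toList.map MvPolynomial.X).prod := by
    rw [prod_map_X, Multiset.coe_toList, Finsupp.toMultiset_toFinsupp]
  rw [MvPolynomial.coe_basisMonomials, LinearMap.comp_apply, LinearMap.mulLeft_apply]
  beta_reduce
  rw [hs,
    ← List.prod_cons, ← List.map_cons, symbolPd_prod_X hf, symbolPd_prod_X (contDiff_pd hf c),
    ← iterPd_concat]
  exact congrFun (iterPd_perm hf (List.perm_append_singleton c _).symm) p

theorem symbolPd_one (f : (ι → 𝕜) → 𝕜) (p : ι → 𝕜) : symbolPd f p 1 = f p := by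
  have := symbolPd_monomial f p 0
  simpa [iterPd] using this

end PartialDerivatives

/-! ### Total derivatives of differential expressions on jets -/

section TotalDerivatives

variable {𝕜 : Type*} [RCLike 𝕜] {n m κ : ℕ}

/-- The coordinate `y^j_s` of a jet, extended by zero to multi-indices that are too long. -/
def Jet.ext (z : Jet 𝕜 n m κ) (j : Fin m) (s : Multiset (Fin n)) : 𝕜 :=
  if h : Multiset.card s ≤ κ then z (Sum.inr (j, ⟨s, h⟩)) else 0

theorem Jet.ext_of_le (z : Jet 𝕜 n m κ) (j : Fin m) {s : Multiset (Fin n)}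
    (h : Multiset.card s ≤ κ) : z.ext j s = z (Sum.inr (j, ⟨s, h⟩)) := dif_pos h

theorem Jet.ext_proj {κ' : ℕ} (hκ : κ' ≤ κ) (z : Jet 𝕜 n m κ) (j : Fin m)
    {s : Multiset (Fin n)} (h : Multiset.card s ≤ κ') : (z.proj hκ).ext j s = z.ext j s := by
  rw [Jet.ext_of_le _ _ h, Jet.ext_of_le _ _ (h.trans hκ)]
  rfl

omit [RCLike 𝕜] in
theorem Jet.base_proj {κ' : ℕ} (hκ : κ' ≤ κ) (z : Jet 𝕜 n m κ) : (z.proj hκ).base = z.base := by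
  funext c
  cases c <;> rfl

theorem Jet.y_eq_ext (z : Jet 𝕜 n m κ) (j : Fin m) {α : Type*} [Fintype α]
    (k : α → Fin n) (h : Fintype.card α ≤ κ) : z.y j k h = z.ext j (multiset k) :=
  (Jet.ext_of_le z j ((card_multiset k).trans_le h)).symm

/-- The direction in which the total derivative differentiates. -/
def totalDir (i : Fin n) (z : Jet 𝕜 n m (κ + 1)) : Jet 𝕜 n m κ :=
  Sum.elim (Pi.single i 1) fun js => z.ext js.1 (i ::ₘ js.2.1)

/-- A total derivative is a directional derivative along a direction depending on the jet, so the
sum, product and chain rules are those of `fderiv`. -/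
theorem totalDeriv_eq_fderiv (i : Fin n) (f : Jet 𝕜 n m κ → 𝕜) (z : Jet 𝕜 n m (κ + 1)) :
    totalDeriv κ i f z = fderiv 𝕜 f (z.proj (Nat.le_succ κ)) (totalDir i z) := by
  rw [pi_eq_sum_univ' (totalDir i z), map_sum, Fintype.sum_sum_type, Fintype.sum_prod_type,
    totalDeriv]
  congr 1
  · rw [Finset.sum_eq_single i]
    · simp [totalDir, pd]
    · intro b _ hb
      simp [totalDir, hb]
    · simp
  · refine Finset.sum_congr rfl fun j _ => Finset.sum_congr rfl fun s _ => ?_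
    rw [map_smul, smul_eq_mul, totalDir, Sum.elim_inr, Jet.ext_of_le]
    rfl

/-- `F` is differentiable and its `i`-th total derivative at `z` is `c`. -/
def HasTotalDeriv (F : Jet 𝕜 n m κ → 𝕜) (i : Fin n) (z : Jet 𝕜 n m (κ + 1)) (c : 𝕜) : Prop :=
  ∃ F' : Jet 𝕜 n m κ →L[𝕜] 𝕜, HasFDerivAt F F' (z.proj (Nat.le_succ κ)) ∧ F' (totalDir i z) = c

namespace HasTotalDeriv

variable {F G : Jet 𝕜 n m κ → 𝕜} {i : Fin n} {z : Jet 𝕜 n m (κ + 1)} {a b : 𝕜}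

theorem totalDeriv (h : HasTotalDeriv F i z a) : totalDeriv κ i F z = a := by
  obtain ⟨F', hF, rfl⟩ := h
  rw [totalDeriv_eq_fderiv, hF.fderiv]

theorem congr (h : HasTotalDeriv F i z a) (hab : a = b) : HasTotalDeriv F i z b := hab ▸ h

theorem add (hF : HasTotalDeriv F i z a) (hG : HasTotalDeriv G i z b) :
    HasTotalDeriv (fun w => F w + G w) i z (a + b) := by
  obtain ⟨F', hF, rfl⟩ := hF
  obtain ⟨G', hG, rfl⟩ := hG
  exact ⟨_, hF.add hG, rfl⟩

theorem sub (hF : HasTotalDeriv F i z a) (hG : HasTotalDeriv G i z b) :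
    HasTotalDeriv (fun w => F w - G w) i z (a - b) := by
  obtain ⟨F', hF, rfl⟩ := hF
  obtain ⟨G', hG, rfl⟩ := hG
  exact ⟨_, hF.sub hG, rfl⟩

theorem mul (hF : HasTotalDeriv F i z a) (hG : HasTotalDeriv G i z b) :
    HasTotalDeriv (fun w => F w * G w) i z
      (a * G (z.proj (Nat.le_succ κ)) + F (z.proj (Nat.le_succ κ)) * b) := by
  obtain ⟨F', hF, rfl⟩ := hF
  obtain ⟨G', hG, rfl⟩ := hG
  refine ⟨_, hF.mul hG, ?_⟩
  simp only [_root_.add_apply, _root_.smul_apply, smul_eq_mul]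
  ring

theorem const (a : 𝕜) : HasTotalDeriv (fun _ : Jet 𝕜 n m κ => a) i z 0 :=
  ⟨0, hasFDerivAt_const _ _, rfl⟩

theorem sum {β : Type*} {S : Finset β} {F : β → Jet 𝕜 n m κ → 𝕜} {a : β → 𝕜}
    (h : ∀ b ∈ S, HasTotalDeriv (F b) i z (a b)) :
    HasTotalDeriv (fun w => ∑ b ∈ S, F b w) i z (∑ b ∈ S, a b) := by
  classical
  induction S using Finset.induction_on with
  | empty => simpa using const (0 : 𝕜)
  | insert b S hb ih =>
    simp only [Finset.sum_insert hb]
    exact (h b (Finset.mem_insert_self b S)).add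
      (ih fun c hc => h c (Finset.mem_insert_of_mem hc))

/-- The length bound makes both sides genuine coordinates, so the default value zero of `Jet.ext`
does not intervene. -/
theorem ext (j : Fin m) {s : Multiset (Fin n)} (h : Multiset.card s ≤ κ) :
    HasTotalDeriv (fun w : Jet 𝕜 n m κ => w.ext j s) i z (z.ext j (i ::ₘ s)) := by
  refine ⟨ContinuousLinearMap.proj (R := 𝕜) (φ := fun _ : JetCoord n m κ => 𝕜)
    (Sum.inr (j, ⟨s, h⟩)), ?_, rfl⟩
  have : (fun w : Jet 𝕜 n m κ => w.ext j s) =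
      ContinuousLinearMap.proj (R := 𝕜) (φ := fun _ : JetCoord n m κ => 𝕜)
        (Sum.inr (j, ⟨s, h⟩)) := by
    funext w
    exact Jet.ext_of_le w j h
  rw [this]
  exact ContinuousLinearMap.hasFDerivAt _

theorem comp_base {f : Base 𝕜 n m → 𝕜} (hf : ContDiff 𝕜 ∞ f) :
    HasTotalDeriv (fun w : Jet 𝕜 n m κ => f w.base) i z
      (pd (Sum.inl i) f z.base + ∑ l, z.ext l {i} * pd (Sum.inr l) f z.base) := by
  let B : Jet 𝕜 n m κ →L[𝕜] Base 𝕜 n m := ContinuousLinearMap.pi fun c =>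
    ContinuousLinearMap.proj (R := 𝕜) (φ := fun _ : JetCoord n m κ => 𝕜)
      (Sum.elim Sum.inl (fun j => Sum.inr (j, ⟨0, Nat.zero_le κ⟩)) c)
  have hB : ∀ w : Jet 𝕜 n m κ, B w = w.base := by
    intro w
    funext c
    cases c <;> rfl
  have hf' : HasFDerivAt f (fderiv 𝕜 f z.base) (B (z.proj (Nat.le_succ κ))) := by
    rw [hB, Jet.base_proj]
    exact ((hf.differentiable (by simp)) _).hasFDerivAt
  refine ⟨_, (hf'.comp _ B.hasFDerivAt).congr_of_eventuallyEq
    (Filter.Eventually.of_forall fun w => by simp [hB]), ?_⟩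
  rw [ContinuousLinearMap.comp_apply, hB, pi_eq_sum_univ' (Jet.base (totalDir i z)), map_sum,
    Fintype.sum_sum_type]
  congr 1
  · rw [Finset.sum_eq_single i]
    · simp [totalDir, pd, Jet.base]
    · intro b _ hb
      simp [totalDir, Jet.base, hb]
    · simp
  · refine Finset.sum_congr rfl fun l _ => ?_
    rw [map_smul, smul_eq_mul]
    rfl

end HasTotalDeriv

/-- The symbol `∑_l y^l_s ∂/∂y^l`. -/
def Jet.symbol (z : Jet 𝕜 n m κ) (s : Multiset (Fin n)) : MvPolynomial (Fin n ⊕ Fin m) 𝕜 :=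
  ∑ l, MvPolynomial.C (z.ext l s) * MvPolynomial.X (Sum.inr l)

theorem Jet.symbol_proj {κ' : ℕ} (hκ : κ' ≤ κ) (z : Jet 𝕜 n m κ)
    {s : Multiset (Fin n)} (h : Multiset.card s ≤ κ') : (z.proj hκ).symbol s = z.symbol s := by
  simp only [Jet.symbol, Jet.ext_proj hκ z _ h]

theorem symbolPd_symbol_mul (f : Base 𝕜 n m → 𝕜) (p : Base 𝕜 n m) (z : Jet 𝕜 n m κ)
    (s : Multiset (Fin n)) (P : MvPolynomial (Fin n ⊕ Fin m) 𝕜) :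
    symbolPd f p (z.symbol s * P) =
      ∑ l, z.ext l s * symbolPd f p (MvPolynomial.X (Sum.inr l) * P) := by
  rw [Jet.symbol, Finset.sum_mul, map_sum]
  refine Finset.sum_congr rfl fun l _ => ?_
  rw [mul_assoc, ← MvPolynomial.smul_eq_C_mul, map_smul, smul_eq_mul]

/-- A factor `X c` of the symbol can be traded for replacing `f` by `pd c f`. Induction on the
polynomial, with `f` varying, thus reduces to the chain rule for a function of the base point. -/
theorem HasTotalDeriv.symbolPd_const {f : Base 𝕜 n m → 𝕜} (hf : ContDiff 𝕜 ∞ f) (i : Fin n)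
    (z : Jet 𝕜 n m (κ + 1)) (P : MvPolynomial (Fin n ⊕ Fin m) 𝕜) :
    HasTotalDeriv (fun w : Jet 𝕜 n m κ => symbolPd f w.base P) i z
      (symbolPd f z.base ((MvPolynomial.X (Sum.inl i) + z.symbol {i}) * P)) := by
  induction P using MvPolynomial.induction_on generalizing f with
  | C a =>
    have h : ∀ g : Base 𝕜 n m → 𝕜, ∀ p, symbolPd g p (MvPolynomial.C a) = a * g p := by
      intro g p
      rw [← mul_one (MvPolynomial.C a), ← MvPolynomial.smul_eq_C_mul, map_smul, symbolPd_one,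
        smul_eq_mul]
    simp only [h]
    refine ((HasTotalDeriv.const a).mul (HasTotalDeriv.comp_base hf)).congr ?_
    rw [add_mul, map_add, symbolPd_X_mul hf, h, symbolPd_symbol_mul]
    simp only [symbolPd_X_mul hf, h, zero_mul, zero_add, mul_add, Finset.mul_sum]
    refine congrArg _ (Finset.sum_congr rfl fun l _ => by ring)
  | add P Q hP hQ =>
    simp only [map_add, mul_add]
    exact (hP hf).add (hQ hf)
  | mul_X P c hP =>
    have h : ∀ p (Q : MvPolynomial (Fin n ⊕ Fin m) 𝕜),
        symbolPd f p (Q * MvPolynomial.X c) = symbolPd (pd c f) p Q := by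
      intro p Q
      rw [mul_comm, symbolPd_X_mul hf]
    simp only [h, ← mul_assoc]
    exact hP (contDiff_pd hf c)

/-- This is the Leibniz rule: the derivative hits the coefficient function, or raises the
multi-index of one factor. In the induction one factor is expanded as a sum of y^l ∂/∂y^l, whose
constant coefficient part is absorbed into `P`; hence `P` is arbitrary. -/
theorem HasTotalDeriv.symbolPd_prod {β : Type*} [DecidableEq β] {f : Base 𝕜 n m → 𝕜}
    (hf : ContDiff 𝕜 ∞ f) (i : Fin n) (z : Jet 𝕜 n m (κ + 1)) (Q : Finset β)
    (s : β → Multiset (Fin n)) (hs : ∀ b ∈ Q, Multiset.card (s b) ≤ κ)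
    (P : MvPolynomial (Fin n ⊕ Fin m) 𝕜) :
    HasTotalDeriv (fun w : Jet 𝕜 n m κ => symbolPd f w.base (P * ∏ b ∈ Q, w.symbol (s b))) i z
      (symbolPd f z.base
        (P * ((MvPolynomial.X (Sum.inl i) + z.symbol {i}) * ∏ b ∈ Q, z.symbol (s b) +
          ∑ b ∈ Q, z.symbol (i ::ₘ s b) * ∏ c ∈ Q.erase b, z.symbol (s c)))) := by
  induction Q using Finset.induction_on generalizing P with
  | empty =>
    simp only [Finset.prod_empty, Finset.sum_empty, mul_one, add_zero]
    exact (HasTotalDeriv.symbolPd_const hf i z P).congr (by rw [mul_comm])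
  | insert b Q hb ih =>
    have hs' : ∀ b ∈ Q, Multiset.card (s b) ≤ κ := fun c hc => hs c (Finset.mem_insert_of_mem hc)
    have hsb := hs b (Finset.mem_insert_self b Q)
    have h1 : ∀ w : Jet 𝕜 n m κ,
        symbolPd f w.base (P * ∏ b ∈ insert b Q, w.symbol (s b)) =
          ∑ l, w.ext l (s b) * symbolPd f w.base (P * MvPolynomial.X (Sum.inr l) *
            ∏ b ∈ Q, w.symbol (s b)) := by
      intro w
      rw [Finset.prod_insert hb, mul_left_comm, symbolPd_symbol_mul]
      simp only [mul_assoc, mul_left_comm P]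
    simp only [h1]
    refine (HasTotalDeriv.sum fun l _ => (HasTotalDeriv.ext l hsb).mul
      (ih hs' (P * MvPolynomial.X (Sum.inr l)))).congr ?_
    have h2 : ∏ c ∈ Q, (z.proj (Nat.le_succ κ)).symbol (s c) = ∏ c ∈ Q, z.symbol (s c) :=
      Finset.prod_congr rfl fun c hc => Jet.symbol_proj _ _ (hs' c hc)
    have h3 : ∀ (t : Multiset (Fin n)) (R : MvPolynomial (Fin n ⊕ Fin m) 𝕜),
        ∑ l, z.ext l t * symbolPd f z.base (P * MvPolynomial.X (Sum.inr l) * R) =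
          symbolPd f z.base (P * (z.symbol t * R)) := by
      intro t R
      rw [mul_left_comm, symbolPd_symbol_mul]
      simp only [mul_assoc, mul_left_comm P]
    simp only [h2, Jet.base_proj, Jet.ext_proj _ _ _ hsb, Finset.sum_add_distrib, h3]
    rw [← map_add]
    congr 1
    rw [Finset.prod_insert hb, Finset.sum_insert hb, Finset.erase_insert hb]
    have h4 : ∀ c ∈ Q, z.symbol (i ::ₘ s c) * ∏ d ∈ (insert b Q).erase c, z.symbol (s d) =
        z.symbol (s b) * (z.symbol (i ::ₘ s c) * ∏ d ∈ Q.erase c, z.symbol (s d)) := by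
      intro c hc
      have hbc : b ≠ c := fun h => hb (h ▸ hc)
      rw [Finset.erase_insert_of_ne hbc, Finset.prod_insert fun h => hb (Finset.mem_of_mem_erase h)]
      ring
    rw [Finset.sum_congr rfl h4, ← Finset.mul_sum]
    ring

end TotalDerivatives

/-! ### Families of disjoint blocks in a finite set -/

section Subpartitions

variable {α : Type*} [DecidableEq α]

/-- The partitions of the subsets of `S`, as sets of nonempty disjoint blocks. -/
def subpartitions (S : Finset α) : Finset (Finset (Finset α)) :=
  S.powerset.powerset.filter fun Q =>
    (∀ B ∈ Q, B.Nonempty) ∧ ∀ B ∈ Q, ∀ C ∈ Q, ∀ a ∈ B, a ∈ C → B = C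

theorem mem_subpartitions {S : Finset α} {Q : Finset (Finset α)} :
    Q ∈ subpartitions S ↔
      (∀ B ∈ Q, B ⊆ S) ∧ (∀ B ∈ Q, B.Nonempty) ∧
        ∀ B ∈ Q, ∀ C ∈ Q, ∀ a ∈ B, a ∈ C → B = C := by
  rw [subpartitions, Finset.mem_filter, Finset.mem_powerset]
  simp only [Finset.subset_iff (s₂ := S.powerset), Finset.mem_powerset]

/-- The three summands record the fate of the new element: uncovered, a block by itself, or a member
of an older block `B`. -/
theorem sum_subpartitions_insert {M : Type*} [AddCommMonoid M] {S : Finset α} {a : α}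
    (ha : a ∉ S) (g : Finset (Finset α) → M) :
    ∑ Q ∈ subpartitions (insert a S), g Q =
      ∑ Q ∈ subpartitions S, (g Q + g (insert {a} Q) +
        ∑ B ∈ Q, g (insert (insert a B) (Q.erase B))) := by
  have hmem : ∀ {Q}, Q ∈ subpartitions S → ∀ B ∈ Q, a ∉ B := fun hQ B hB h =>
    ha ((mem_subpartitions.1 hQ).1 B hB h)
  rw [Finset.sum_add_distrib, Finset.sum_add_distrib,
    ← Finset.sum_filter_add_sum_filter_not (subpartitions (insert a S)) (fun Q => ∀ B ∈ Q, a ∉ B),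
    ← Finset.sum_filter_add_sum_filter_not
      ((subpartitions (insert a S)).filter fun Q => ¬ ∀ B ∈ Q, a ∉ B) (fun Q => {a} ∈ Q),
    ← add_assoc]
  congr 1
  · congr 1
    · refine Finset.sum_congr (Finset.ext fun Q => ?_) fun _ _ => rfl
      rw [Finset.mem_filter]
      constructor
      · rintro ⟨hQ, h⟩
        rw [mem_subpartitions] at hQ ⊢
        exact ⟨fun B hB => (Finset.subset_insert_iff_of_notMem (h B hB)).1 (hQ.1 B hB), hQ.2⟩
      · refine fun hQ => ⟨?_, hmem hQ⟩
        rw [mem_subpartitions] at hQ ⊢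
        exact ⟨fun B hB => (hQ.1 B hB).trans (Finset.subset_insert a S), hQ.2⟩
    · refine (Finset.sum_bij' (fun Q _ => insert {a} Q) (fun Q _ => Q.erase {a}) ?_ ?_ ?_ ?_
        fun _ _ => rfl).symm
      · intro Q hQ
        have := hmem hQ
        simp only [Finset.mem_filter, mem_subpartitions] at hQ ⊢
        grind
      · intro Q hQ
        simp only [Finset.mem_filter, mem_subpartitions] at hQ ⊢
        obtain ⟨⟨⟨h1, h2, h3⟩, -⟩, h5⟩ := hQ
        have h6 : ∀ B ∈ Q, B ≠ {a} → a ∉ B := fun B hB hne haB =>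
          hne (h3 B hB {a} h5 a haB (Finset.mem_singleton_self a))
        refine ⟨fun B hB => ?_, fun B hB => h2 B (Finset.mem_of_mem_erase hB), fun B hB C hC =>
          h3 B (Finset.mem_of_mem_erase hB) C (Finset.mem_of_mem_erase hC)⟩
        obtain ⟨hne, hB⟩ := Finset.mem_erase.1 hB
        exact (Finset.subset_insert_iff_of_notMem (h6 B hB hne)).1 (h1 B hB)
      · intro Q hQ
        exact Finset.erase_insert fun h => hmem hQ _ h (Finset.mem_singleton_self a)
      · intro Q hQ
        exact Finset.insert_erase (Finset.mem_filter.1 hQ).2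
  · rw [Finset.sum_sigma']
    refine (Finset.sum_bij (fun (q : Σ _ : Finset (Finset α), Finset α) _ =>
      insert (insert a q.2) (q.1.erase q.2)) ?_ ?_ ?_ fun _ _ => rfl).symm
    · rintro ⟨Q, B⟩ h
      obtain ⟨hQ, hB⟩ := Finset.mem_sigma.1 h
      have hm := hmem hQ
      simp only [Finset.mem_filter, mem_subpartitions] at hQ hB ⊢
      obtain ⟨h1, h2, h3⟩ := hQ
      refine ⟨⟨⟨?_, ?_, ?_⟩, ?_⟩, ?_⟩
      · intro C hC
        rcases Finset.mem_insert.1 hC with rfl | hC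
        · exact Finset.insert_subset_insert a (h1 B hB)
        · exact (h1 C (Finset.mem_of_mem_erase hC)).trans (Finset.subset_insert a S)
      · intro C hC
        rcases Finset.mem_insert.1 hC with rfl | hC
        · exact Finset.insert_nonempty a B
        · exact h2 C (Finset.mem_of_mem_erase hC)
      · grind
      · intro h
        exact h _ (Finset.mem_insert_self _ _) (Finset.mem_insert_self a B)
      · intro h
        rcases Finset.mem_insert.1 h with h | h
        · obtain ⟨b, hb⟩ := h2 B hB
          have : b ∈ ({a} : Finset α) := h ▸ Finset.mem_insert_of_mem hb
          exact hm B hB (Finset.mem_singleton.1 this ▸ hb)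
        · exact hm _ (Finset.mem_of_mem_erase h) (Finset.mem_singleton_self a)
    · rintro ⟨Q, B⟩ h ⟨Q', B'⟩ h' heq
      obtain ⟨hQ, hB⟩ := Finset.mem_sigma.1 h
      obtain ⟨hQ', hB'⟩ := Finset.mem_sigma.1 h'
      have hm := hmem hQ
      have hm' := hmem hQ'
      dsimp only at heq hB hB' hm hm'
      -- The enlarged block is recognizable as the only one containing `a`.
      have hBB : insert a B = insert a B' := by
        have : insert a B ∈ insert (insert a B') (Q'.erase B') :=
          heq ▸ Finset.mem_insert_self _ _
        rcases Finset.mem_insert.1 this with h | h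
        · exact h
        · exact absurd (Finset.mem_insert_self a B) (hm' _ (Finset.mem_of_mem_erase h))
      have hB : B = B' := by
        rw [← Finset.erase_insert (hm B hB), hBB, Finset.erase_insert (hm' B' hB')]
      subst hB
      have hQQ : Q.erase B = Q'.erase B := by
        rw [← Finset.erase_insert (s := Q.erase B) (a := insert a B) fun h =>
          hm _ (Finset.mem_of_mem_erase h) (Finset.mem_insert_self a B), heq,
          Finset.erase_insert fun h =>
          hm' _ (Finset.mem_of_mem_erase h) (Finset.mem_insert_self a B)]
      have : Q = Q' := by
        rw [← Finset.insert_erase hB, hQQ, Finset.insert_erase hB']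
      rw [this]
    · intro Q hQ
      simp only [Finset.mem_filter, mem_subpartitions] at hQ
      obtain ⟨⟨⟨h1, h2, h3⟩, h4⟩, h5⟩ := hQ
      push Not at h4
      obtain ⟨B, hB, haB⟩ := h4
      have h6 : ∀ C ∈ Q.erase B, a ∉ C := fun C hC haC =>
        Finset.ne_of_mem_erase hC (h3 C (Finset.mem_of_mem_erase hC) B hB a haC haB)
      have h7 : B.erase a ∉ Q.erase B := by
        intro h
        obtain ⟨b, hb⟩ := h2 _ (Finset.mem_of_mem_erase h)
        exact Finset.ne_of_mem_erase h (h3 _ (Finset.mem_of_mem_erase h) B hB b hb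
          (Finset.mem_of_mem_erase hb))
      -- Since {a} is not a block here, something remains of the block of `a` after deleting `a`.
      have h8 : (B.erase a).Nonempty := by
        rw [Finset.nonempty_iff_ne_empty]
        intro h
        rcases Finset.erase_eq_empty_iff _ _ |>.1 h with h | h
        · exact Finset.not_nonempty_empty (h ▸ h2 B hB)
        · exact h5 (h ▸ hB)
      refine ⟨⟨insert (B.erase a) (Q.erase B), B.erase a⟩, ?_, ?_⟩
      · refine Finset.mem_sigma.2 ⟨mem_subpartitions.2 ⟨?_, ?_, ?_⟩, Finset.mem_insert_self _ _⟩
        · intro C hC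
          rcases Finset.mem_insert.1 hC with rfl | hC
          · exact Finset.subset_insert_iff.1 (h1 B hB)
          · exact (Finset.subset_insert_iff_of_notMem (h6 C hC)).1
              (h1 C (Finset.mem_of_mem_erase hC))
        · intro C hC
          rcases Finset.mem_insert.1 hC with rfl | hC
          · exact h8
          · exact h2 C (Finset.mem_of_mem_erase hC)
        · grind
      · dsimp only
        rw [Finset.insert_erase haB, Finset.erase_insert h7, Finset.insert_erase hB]

end Subpartitions

/-! ### Closed forms of iterated total derivatives and of Lie's recursion -/

section Prolongation

variable {𝕜 : Type*} [RCLike 𝕜] {n m κ : ℕ} {α : Type*} [DecidableEq α]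

/-- The contribution of the partition `Q` of a subset of `S` to the iterated total derivative of
`f` with respect to the indices `i a`, `a ∈ S`. -/
def partitionTerm (f : Base 𝕜 n m → 𝕜) (i : α → Fin n) (S : Finset α) (Q : Finset (Finset α))
    (z : Jet 𝕜 n m κ) : 𝕜 :=
  symbolPd f z.base ((∏ a ∈ S \ Q.biUnion id, MvPolynomial.X (Sum.inl (i a))) *
    ∏ B ∈ Q, z.symbol (B.val.map i))

/-- The iterated total derivative of `f` with respect to the indices `i a`, `a ∈ S`. -/
def iterTotalDeriv (f : Base 𝕜 n m → 𝕜) (i : α → Fin n) (S : Finset α) (z : Jet 𝕜 n m κ) : 𝕜 :=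
  ∑ Q ∈ subpartitions S, partitionTerm f i S Q z

/-- Blocks in `S` have at most `S.card` elements, so no jet coordinate of higher order occurs. -/
theorem iterTotalDeriv_proj {κ' : ℕ} (hκ : κ' ≤ κ) (f : Base 𝕜 n m → 𝕜) (i : α → Fin n)
    {S : Finset α} (hS : S.card ≤ κ') (z : Jet 𝕜 n m κ) :
    iterTotalDeriv f i S (z.proj hκ) = iterTotalDeriv f i S z := by
  refine Finset.sum_congr rfl fun Q hQ => ?_
  rw [partitionTerm, partitionTerm, Jet.base_proj]
  congr 2
  refine Finset.prod_congr rfl fun B hB => Jet.symbol_proj _ _ ?_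
  rw [Multiset.card_map]
  exact (Finset.card_le_card ((mem_subpartitions.1 hQ).1 B hB)).trans hS

theorem iterTotalDeriv_empty (f : Base 𝕜 n m → 𝕜) (i : α → Fin n) (z : Jet 𝕜 n m κ) :
    iterTotalDeriv f i ∅ z = f z.base := by
  have : subpartitions (∅ : Finset α) = {∅} := by
    ext Q
    rw [mem_subpartitions, Finset.mem_singleton]
    constructor
    · rintro ⟨h1, h2, -⟩
      refine Finset.eq_empty_of_forall_notMem fun B hB => ?_
      exact (h2 B hB).ne_empty (Finset.subset_empty.1 (h1 B hB))
    · rintro rfl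
      simp
  rw [iterTotalDeriv, this, Finset.sum_singleton, partitionTerm]
  simp [symbolPd_one]

/-- For each family the Leibniz rule gives an ∂/∂x term, a new factor for {a}, and terms with one
enlarged block. These are the three cases of `sum_subpartitions_insert`. -/
theorem HasTotalDeriv.iterTotalDeriv {f : Base 𝕜 n m → 𝕜} (hf : ContDiff 𝕜 ∞ f) (i : α → Fin n)
    {S : Finset α} {a : α} (ha : a ∉ S) (hS : S.card ≤ κ) (z : Jet 𝕜 n m (κ + 1)) :
    HasTotalDeriv (fun w : Jet 𝕜 n m κ => iterTotalDeriv f i S w) (i a) z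
      (iterTotalDeriv f i (insert a S) z) := by
  unfold LieProlongation.iterTotalDeriv
  rw [sum_subpartitions_insert ha]
  refine HasTotalDeriv.sum fun Q hQ => ?_
  have hQ' := mem_subpartitions.1 hQ
  have haQ : ∀ B ∈ Q, a ∉ B := fun B hB h => ha (hQ'.1 B hB h)
  have hcard : ∀ B ∈ Q, Multiset.card (B.val.map i) ≤ κ := fun B hB => by
    rw [Multiset.card_map]
    exact (Finset.card_le_card (hQ'.1 B hB)).trans hS
  unfold partitionTerm
  refine (HasTotalDeriv.symbolPd_prod hf (i a) z Q (fun B => B.val.map i) hcard _).congr ?_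
  have haU : a ∉ Q.biUnion id := by
    simpa using haQ
  have h1 : insert a S \ Q.biUnion id = insert a (S \ Q.biUnion id) :=
    Finset.insert_sdiff_of_notMem S haU
  have h2 : ∀ U : Finset α, insert a S \ insert a U = S \ U := fun U => by
    rw [Finset.insert_sdiff_insert]
    exact Finset.sdiff_insert_of_notMem ha U
  have h3 : (insert {a} Q).biUnion id = insert a (Q.biUnion id) := by
    rw [Finset.biUnion_insert, id, Finset.singleton_union]
  have h4 : ∀ B ∈ Q, (insert (insert a B) (Q.erase B)).biUnion id = insert a (Q.biUnion id) := by
    intro B hB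
    rw [Finset.biUnion_insert, id, Finset.insert_union]
    conv_rhs => rw [← Finset.insert_erase hB, Finset.biUnion_insert, id]
  have h5 : {a} ∉ Q := fun h => haQ _ h (Finset.mem_singleton_self a)
  have h6 : ∀ B, insert a B ∉ Q.erase B := fun B h =>
    haQ _ (Finset.mem_of_mem_erase h) (Finset.mem_insert_self a B)
  have h7 : ∑ B ∈ Q, symbolPd f z.base
      ((∏ b ∈ insert a S \ (insert (insert a B) (Q.erase B)).biUnion id,
          MvPolynomial.X (Sum.inl (i b))) *
        ∏ C ∈ insert (insert a B) (Q.erase B), z.symbol (C.val.map i)) =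
      ∑ B ∈ Q, symbolPd f z.base ((∏ b ∈ S \ Q.biUnion id, MvPolynomial.X (Sum.inl (i b))) *
        (z.symbol (i a ::ₘ B.val.map i) * ∏ C ∈ Q.erase B, z.symbol (C.val.map i))) := by
    refine Finset.sum_congr rfl fun B hB => ?_
    rw [h4 B hB, h2, Finset.prod_insert (h6 B), Finset.insert_val_of_notMem (haQ B hB),
      Multiset.map_cons]
  rw [h7, h1, h3, h2, Finset.prod_insert h5,
    Finset.prod_insert fun h => ha (Finset.mem_sdiff.1 h).1, ← map_sum, ← Finset.mul_sum,
    ← map_add, ← map_add]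
  congr 1
  rw [Finset.singleton_val, Multiset.map_singleton]
  ring

/-- The extra term is `S` itself, which becomes a proper subset once `a` is adjoined. -/
theorem sum_ssubsets_insert {M : Type*} [AddCommGroup M] {S : Finset α} {a : α} (ha : a ∉ S)
    (g : Finset α → M) :
    ∑ U ∈ (insert a S).ssubsets, g U = ∑ U ∈ S.ssubsets, (g U + g (insert a U)) + g S := by
  have h : ∀ (T : Finset α) (g : Finset α → M),
      ∑ U ∈ T.ssubsets, g U = ∑ U ∈ T.powerset, g U - g T := fun T g => by
    rw [Finset.ssubsets, Finset.sum_erase_eq_sub (Finset.mem_powerset_self T)]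
  rw [h, h, Finset.sum_add_distrib, Finset.sum_powerset_insert ha]
  abel

theorem multiset_snoc {β : Type*} (g : Fin κ → β) (b : β) :
    multiset (Fin.snoc (α := fun _ => β) g b) = b ::ₘ multiset g := by
  rw [multiset, multiset, Fin.univ_castSuccEmb, Finset.cons_val, Multiset.map_cons,
    Fin.snoc_last, Finset.map_val, Multiset.map_map]
  congr 1
  refine Multiset.map_congr rfl fun x _ => ?_
  simp

theorem map_val_image_univ {β γ : Type*} [Fintype γ] {a : γ → α} (ha : Function.Injective a)
    (i : α → β) : (Finset.univ.image a).val.map i = multiset fun b => i (a b) := by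
  rw [Finset.image_val_of_injOn ha.injOn, Multiset.map_map, multiset]
  rfl

/-- Positions are taken in a fixed type `α` through an injection, so that the sets in the induction
all live in one type and `α` may contain a spare element, later the marker. -/
theorem prolongCoeff_eq {X : Fin n → Base 𝕜 n m → 𝕜} {Y : Fin m → Base 𝕜 n m → 𝕜}
    (hX : ∀ k, ContDiff 𝕜 ∞ (X k)) (hY : ∀ j, ContDiff 𝕜 ∞ (Y j)) (j : Fin m) (i : α → Fin n)
    {a : Fin κ → α} (ha : Function.Injective a) (z : Jet 𝕜 n m κ) :
    prolongCoeff X Y j κ (fun b => i (a b)) z =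
      iterTotalDeriv (Y j) i (Finset.univ.image a) z -
        ∑ U ∈ (Finset.univ.image a).ssubsets, ∑ k,
          z.ext j (k ::ₘ U.val.map i) * iterTotalDeriv (X k) i (Finset.univ.image a \ U) z := by
  induction κ with
  | zero =>
    have h : (Finset.univ.image a) = ∅ := by simp
    rw [h, iterTotalDeriv_empty]
    simp [prolongCoeff, Finset.ssubsets]
  | succ κ ih =>
    have ha' : Function.Injective fun b : Fin κ => a b.castSucc :=
      ha.comp (Fin.castSucc_injective κ)
    set S : Finset α := Finset.univ.image fun b : Fin κ => a b.castSucc with hS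
    set b := a (Fin.last κ) with hb
    have hbS : b ∉ S := by
      simp only [hS, Finset.mem_image, Finset.mem_univ, true_and, not_exists]
      exact fun c hc => (Fin.castSucc_lt_last c).ne (ha hc)
    have hSκ : S.card = κ := by
      rw [hS, Finset.card_image_of_injective _ ha', Finset.card_univ, Fintype.card_fin]
    have himage : Finset.univ.image a = insert b S := by
      rw [Fin.univ_castSuccEmb, Finset.cons_eq_insert, Finset.image_insert, Finset.map_eq_image,
        Finset.image_image]
      rfl
    have hU : ∀ U ∈ S.ssubsets, U.card + 1 ≤ κ ∧ b ∉ U := fun U hU => by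
      rw [Finset.mem_ssubsets] at hU
      exact ⟨hSκ ▸ Finset.card_lt_card hU, fun h => hbS (hU.1 h)⟩
    have hSU : ∀ U, (S \ U).card ≤ κ := fun U => (Finset.card_le_card Finset.sdiff_subset).trans
      hSκ.le
    have h1 := (HasTotalDeriv.iterTotalDeriv (hY j) i hbS hSκ.le z).sub
      (HasTotalDeriv.sum (S := S.ssubsets) (i := i b) fun U hU' =>
        HasTotalDeriv.sum (S := Finset.univ) fun k _ =>
          (HasTotalDeriv.ext (i := i b) (z := z) j (s := k ::ₘ U.val.map i)
            (by rw [Multiset.card_cons, Multiset.card_map]; exact (hU U hU').1)).mul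
          (HasTotalDeriv.iterTotalDeriv (hX k) i (S := S \ U)
            (fun h => hbS (Finset.mem_sdiff.1 h).1) (hSU U) z))
    have h2 : ∀ k, totalDeriv 0 (i b) (fun w : Jet 𝕜 n m 0 => X k w.base)
        (z.proj (Nat.succ_le_succ (Nat.zero_le κ))) = iterTotalDeriv (X k) i {b} z := by
      intro k
      have := (HasTotalDeriv.iterTotalDeriv (κ := 0) (hX k) i (Finset.notMem_empty b) le_rfl
        (z.proj (Nat.succ_le_succ (Nat.zero_le κ)))).totalDeriv
      simp only [iterTotalDeriv_empty, insert_empty_eq] at this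
      rw [this, iterTotalDeriv_proj]
      simp
    have h3 : (fun w : Jet 𝕜 n m κ => prolongCoeff X Y j κ (fun c => i (a c.castSucc)) w) = _ :=
      funext fun w => ih ha' w
    have h4 : prolongCoeff X Y j (κ + 1) (fun b => i (a b)) z =
        totalDeriv κ (i b) (fun w => prolongCoeff X Y j κ (fun c => i (a c.castSucc)) w) z -
        ∑ k : Fin n,
          totalDeriv 0 (i b) (fun w : Jet 𝕜 n m 0 => X k w.base)
              (z.proj (Nat.succ_le_succ (Nat.zero_le κ))) *
            z.y j (Fin.snoc (α := fun _ => Fin n) (fun c => i (a c.castSucc)) k)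
              (Fintype.card_fin (κ + 1)).le := rfl
    rw [h4, h3, h1.totalDeriv, himage, sum_ssubsets_insert hbS, sub_sub]
    -- The first goal matches the Leibniz terms: differentiating y^j_{k,U} enlarges U, and
    -- differentiating D_{S∖U} X^k keeps U. The second identifies Lie's correction with the term U =
    -- S.
    congr 2
    · refine Finset.sum_congr rfl fun U hU' => ?_
      rw [← Finset.sum_add_distrib]
      refine Finset.sum_congr rfl fun k _ => ?_
      rw [iterTotalDeriv_proj _ _ _ (hSU U), Jet.ext_proj _ _ _
        (by rw [Multiset.card_cons, Multiset.card_map]; exact (hU U hU').1),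
        Finset.insert_sdiff_of_notMem _ (hU U hU').2, Finset.insert_sdiff_insert,
        Finset.sdiff_insert_of_notMem hbS, Finset.insert_val_of_notMem (hU U hU').2,
        Multiset.map_cons, Multiset.cons_swap, add_comm]
    · refine Finset.sum_congr rfl fun k _ => ?_
      rw [h2, Jet.y_eq_ext, multiset_snoc, hS, map_val_image_univ ha', ← hS,
        Finset.insert_sdiff_of_notMem _ hbS, Finset.sdiff_self, insert_empty_eq, mul_comm]

end Prolongation

/-! ### Labellings of blocks and the stabilizer of the monomial -/

namespace Shape

variable {κ d : ℕ} (s : Shape κ d)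

section Parts

variable {α : Type*} [DecidableEq α]

/-- The image of the labels `e : ν : γ` in the block `b = e : ν`. -/
def blockImage (φ : s.Pos → α) (b : s.Block) : Finset α :=
  Finset.univ.image fun γ => φ (s.pos b γ)

/-- The images of all the blocks. -/
def parts (φ : s.Pos → α) : Finset (Finset α) := Finset.univ.image (s.blockImage φ)

/-- The sizes of the blocks. -/
def sizes : Multiset ℕ := multiset fun b : s.Block => s.len b.1

variable {s}

theorem pos_injective (b : s.Block) : Function.Injective (s.pos b) := by
  intro γ γ' h
  simpa [pos] using h

theorem mem_blockImage {φ : s.Pos → α} {b : s.Block} {a : α} :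
    a ∈ s.blockImage φ b ↔ ∃ p, s.toBlock p = b ∧ φ p = a := by
  simp only [blockImage, Finset.mem_image, Finset.mem_univ, true_and]
  constructor
  · rintro ⟨γ, h⟩
    exact ⟨s.pos b γ, rfl, h⟩
  · rintro ⟨⟨e, ν, γ⟩, rfl, h⟩
    exact ⟨γ, h⟩

theorem mem_parts {φ : s.Pos → α} {B : Finset α} :
    B ∈ s.parts φ ↔ ∃ b, s.blockImage φ b = B := by
  simp [parts]

theorem blockImage_nonempty (φ : s.Pos → α) (b : s.Block) : (s.blockImage φ b).Nonempty :=
  ⟨φ (s.pos b ⟨0, s.one_le_len b.1⟩), mem_blockImage.2 ⟨_, rfl, rfl⟩⟩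

theorem biUnion_parts (φ : s.Pos → α) : (s.parts φ).biUnion id = Finset.univ.image φ := by
  ext a
  simp only [Finset.mem_biUnion, mem_parts, id, Finset.mem_image, Finset.mem_univ, true_and]
  constructor
  · rintro ⟨_, ⟨b, rfl⟩, h⟩
    obtain ⟨p, -, h⟩ := mem_blockImage.1 h
    exact ⟨p, h⟩
  · rintro ⟨p, h⟩
    exact ⟨_, ⟨s.toBlock p, rfl⟩, mem_blockImage.2 ⟨p, rfl, h⟩⟩

variable {φ : s.Pos → α} (hφ : Function.Injective φ)
include hφ

theorem apply_mem_blockImage {p : s.Pos} {b : s.Block} :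
    φ p ∈ s.blockImage φ b ↔ s.toBlock p = b := by
  rw [mem_blockImage]
  constructor
  · rintro ⟨q, h, h'⟩
    rwa [← hφ h']
  · exact fun h => ⟨p, h, rfl⟩

theorem blockImage_injective : Function.Injective (s.blockImage φ) := by
  intro b b' h
  obtain ⟨a, ha⟩ := blockImage_nonempty φ b
  obtain ⟨p, hp, rfl⟩ := mem_blockImage.1 ha
  rw [← hp, ← apply_mem_blockImage hφ, ← h]
  exact ha

theorem map_val_blockImage {β : Type*} (k : α → β) (b : s.Block) :
    (s.blockImage φ b).val.map k = multiset fun γ => k (φ (s.pos b γ)) :=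
  map_val_image_univ (hφ.comp (pos_injective b)) k

theorem card_blockImage (b : s.Block) : (s.blockImage φ b).card = s.len b.1 := by
  have h : Function.Injective fun γ => φ (s.pos b γ) := hφ.comp (pos_injective b)
  rw [blockImage, Finset.card_image_of_injective _ h, Finset.card_univ, Fintype.card_fin]

theorem map_val_parts {β : Type*} (g : Finset α → β) :
    (s.parts φ).val.map g = multiset fun b => g (s.blockImage φ b) :=
  map_val_image_univ (blockImage_injective hφ) g

theorem parts_mem_subpartitions [Fintype α] : s.parts φ ∈ subpartitions Finset.univ := by
  refine mem_subpartitions.2 ⟨fun B _ => Finset.subset_univ B, ?_, ?_⟩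
  · intro B hB
    obtain ⟨b, rfl⟩ := mem_parts.1 hB
    exact blockImage_nonempty φ b
  · intro B hB C hC a haB haC
    obtain ⟨b, rfl⟩ := mem_parts.1 hB
    obtain ⟨c, rfl⟩ := mem_parts.1 hC
    obtain ⟨p, rfl, rfl⟩ := mem_blockImage.1 haB
    rw [(apply_mem_blockImage hφ).1 haC]

theorem map_card_parts : (s.parts φ).val.map Finset.card = s.sizes := by
  rw [map_val_parts hφ, sizes]
  simp only [card_blockImage hφ]

theorem monomial_comp (k : α → ℕ) :
    s.monomial (fun p => k (φ p)) = (s.parts φ).val.map fun B => B.val.map k := by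
  rw [map_val_parts hφ, monomial]
  simp only [map_val_blockImage hφ]

/-- The generic monomial remembers exactly which labels share a factor. Injective numerical indices
recover the blocks from the monomial; conversely the blocks determine the monomial for all indices.
-/
theorem mem_stabilizer_iff [Countable α] {h : Equiv.Perm s.Pos} :
    h ∈ s.stabilizer ↔ s.parts (fun p => φ (h p)) = s.parts φ := by
  have hφh : Function.Injective fun p => φ (h p) := hφ.comp h.injective
  constructor
  · intro hh
    obtain ⟨k, hk⟩ := exists_injective_nat α
    have h1 := hh fun p => k (φ p)
    rw [monomial_comp hφ k, monomial_comp hφh k] at h1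
    refine Finset.val_injective (Multiset.map_injective ?_ h1)
    exact (Multiset.map_injective hk).comp Finset.val_injective
  · intro hh k
    -- Indices on the labels are transported to `α` along `φ`; the value 0 off the range is never
    -- read.
    have hk : ∀ p, Function.extend φ k 0 (φ p) = k p := hφ.extend_apply k 0
    have h1 := monomial_comp hφh (Function.extend φ k 0)
    rw [hh, ← monomial_comp hφ] at h1
    simpa only [hk] using h1

-- Equal multisets of sizes mean equally many blocks of each size. This gives a size-preserving
-- matching of blocks, and bijections inside matched blocks glue to a labelling, injective because
-- the blocks of `Q` are disjoint.
omit hφ in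
theorem exists_parts_eq {Q : Finset (Finset α)}
    (hQ : ∀ B ∈ Q, ∀ C ∈ Q, ∀ a ∈ B, a ∈ C → B = C) (hs : Q.val.map Finset.card = s.sizes) :
    ∃ φ : s.Pos → α, Function.Injective φ ∧ s.parts φ = Q := by
  have hcard : ∀ c : ℕ, Fintype.card {b : s.Block // s.len b.1 = c} =
      Fintype.card {B : Q // B.1.card = c} := by
    intro c
    have h := congrArg (Multiset.count c) hs
    rw [Multiset.count_map, sizes, multiset, Multiset.count_map] at h
    rw [Fintype.card_subtype, Fintype.card_subtype]
    have h1 : (Finset.univ.filter fun B : Q => B.1.card = c).card =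
        (Q.filter fun B => c = B.card).card := by
      rw [← Finset.card_map (Function.Embedding.subtype _)]
      congr 1
      ext B
      simp [eq_comm, and_comm]
    have h2 : (Finset.univ.filter fun b : s.Block => s.len b.1 = c) =
        Finset.univ.filter fun b : s.Block => c = s.len b.1 := by
      simp only [eq_comm]
    rw [h1, h2]
    exact h.symm
  let η : ∀ c : ℕ, {b : s.Block // s.len b.1 = c} ≃ {B : Q // B.1.card = c} :=
    fun c => Fintype.equivOfCardEq (hcard c)
  let β : s.Block ≃ Q := Equiv.ofFiberEquiv η
  have hβ : ∀ b, (β b).1.card = s.len b.1 := Equiv.ofFiberEquiv_map η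
  let ε : ∀ b : s.Block, Fin (s.len b.1) ≃ (β b).1 := fun b =>
    ((β b).1.equivFinOfCardEq (hβ b)).symm
  have hblock : ∀ b, s.blockImage (fun p => (ε (s.toBlock p) p.2.2 : α)) b = (β b).1 := by
    intro b
    ext a
    simp only [blockImage, Finset.mem_image, Finset.mem_univ, true_and]
    constructor
    · rintro ⟨γ, rfl⟩
      exact (ε b γ).2
    · intro ha
      exact ⟨(ε b).symm ⟨a, ha⟩, congrArg Subtype.val ((ε b).apply_symm_apply ⟨a, ha⟩)⟩
  refine ⟨fun p => ε (s.toBlock p) p.2.2, ?_, ?_⟩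
  · rintro ⟨e, ν, γ⟩ ⟨e', ν', γ'⟩ h
    have hb : (⟨e, ν⟩ : s.Block) = ⟨e', ν'⟩ := by
      refine β.injective (Subtype.ext (hQ _ (β _).2 _ (β _).2 _ (ε ⟨e, ν⟩ γ).2 ?_))
      have h' : (ε ⟨e, ν⟩ γ : α) = ε ⟨e', ν'⟩ γ' := h
      rw [h']
      exact (ε ⟨e', ν'⟩ γ').2
    obtain ⟨rfl, hν⟩ := Sigma.mk.inj hb
    obtain rfl := eq_of_heq hν
    have : γ = γ' := (ε ⟨e, ν⟩).injective (Subtype.ext h)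
    rw [this]
  · ext B
    rw [mem_parts]
    simp only [hblock]
    constructor
    · rintro ⟨b, rfl⟩
      exact (β b).2
    · exact fun hB => ⟨β.symm ⟨B, hB⟩, by rw [β.apply_symm_apply]⟩

end Parts

/-- The index `t` runs through the admissible supports, each enumerated by `Ψ t`. Labellings of one
support form a torsor under the permutations of the labels, and changing σ within its class does not
change the blocks. The predicate `p` makes the lemma serve for supports without and with the marker.
-/
theorem sum_representatives {α M K : Type*} [DecidableEq α] [Fintype α] [AddCommMonoid M]
    [Fintype K] {s : Shape κ d} {F : Finset (Equiv.Perm s.Pos)}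
    (hF : Subgroup.IsComplement (s.stabilizer : Set (Equiv.Perm s.Pos))
      (F : Set (Equiv.Perm s.Pos)))
    {Ψ : K → Fin s.weight → α} (hΨ : ∀ t, Function.Injective (Ψ t))
    (hΨ' : ∀ t t', Finset.univ.image (Ψ t) = Finset.univ.image (Ψ t') → t = t')
    {p : Finset α → Prop} [DecidablePred p]
    (hp : ∀ T : Finset α, T.card = s.weight → (p T ↔ ∃ t, Finset.univ.image (Ψ t) = T))
    (W : Finset (Finset α) → M) :
    ∑ σ ∈ F, ∑ t, W (s.parts fun q => Ψ t (s.enum (σ⁻¹ q))) =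
      ∑ Q ∈ (subpartitions Finset.univ).filter
        (fun Q => p (Q.biUnion id) ∧ Q.val.map Finset.card = s.sizes), W Q := by
  have hinj : ∀ t (σ : Equiv.Perm s.Pos), Function.Injective fun q => Ψ t (s.enum (σ⁻¹ q)) :=
    fun t σ => (hΨ t).comp (s.enum.injective.comp (σ⁻¹).injective)
  have himage : ∀ t (σ : Equiv.Perm s.Pos),
      (s.parts fun q => Ψ t (s.enum (σ⁻¹ q))).biUnion id = Finset.univ.image (Ψ t) := by
    intro t σ
    rw [biUnion_parts]
    ext a
    simp only [Finset.mem_image, Finset.mem_univ, true_and]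
    exact ((σ⁻¹).trans s.enum).exists_congr_left.trans (by simp)
  rw [← Finset.sum_product']
  refine Finset.sum_bij (fun q _ => s.parts fun r => Ψ q.2 (s.enum (q.1⁻¹ r))) ?_ ?_ ?_
    fun _ _ => rfl
  · rintro ⟨σ, t⟩ -
    refine Finset.mem_filter.2 ⟨parts_mem_subpartitions (hinj t σ), ?_, map_card_parts (hinj t σ)⟩
    dsimp only
    rw [himage, hp _ (by rw [Finset.card_image_of_injective _ (hΨ t)]; simp)]
    exact ⟨t, rfl⟩
  · rintro ⟨σ, t⟩ hq ⟨σ', t'⟩ hq' h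
    have hσ := (Finset.mem_product.1 hq).1
    have hσ' := (Finset.mem_product.1 hq').1
    dsimp only at h hσ hσ'
    -- The support is the union of the blocks, so it determines `t`.
    obtain rfl : t = t' := hΨ' _ _ (by rw [← himage t σ, h, himage])
    have h1 : σ * σ'⁻¹ ∈ s.stabilizer := by
      rw [mem_stabilizer_iff (hinj t σ), h]
      simp
    -- Two factorizations of σ, namely (σσ'⁻¹)σ' and 1·σ, must coincide.
    have h2 := hF.injective (a₁ := (⟨σ * σ'⁻¹, h1⟩, ⟨σ', hσ'⟩)) (a₂ := (1, ⟨σ, hσ⟩)) (by simp)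
    exact Prod.ext (congrArg (fun q => q.2.1) h2).symm rfl
  · intro Q hQ
    obtain ⟨hQ, hpQ, hsize⟩ := Finset.mem_filter.1 hQ
    obtain ⟨φ, hφ, rfl⟩ := exists_parts_eq (mem_subpartitions.1 hQ).2.2 hsize
    rw [biUnion_parts, hp _ (by
      rw [Finset.card_image_of_injective _ hφ, Finset.card_univ, Fintype.card_congr s.enum,
        Fintype.card_fin])] at hpQ
    obtain ⟨t, ht⟩ := hpQ
    have hex : ∀ q, ∃ r, Ψ t (s.enum r) = φ q := by
      intro q
      have : φ q ∈ Finset.univ.image (Ψ t) := ht ▸ Finset.mem_image_of_mem φ (Finset.mem_univ q)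
      obtain ⟨a, -, ha⟩ := Finset.mem_image.1 this
      exact ⟨s.enum.symm a, by rw [Equiv.apply_symm_apply, ha]⟩
    choose g hg using hex
    have hg_inj : Function.Injective g := fun q r h => hφ (by rw [← hg, h, hg])
    let ρ : Equiv.Perm s.Pos := Equiv.ofBijective g (Finite.injective_iff_bijective.1 hg_inj)
    -- The labelling is inverted before factoring because σ enters through σ⁻¹: from ρ⁻¹ = hσ
    -- follows σ⁻¹ = ρh, a relabelling by the stabilizer.
    obtain ⟨⟨⟨h, hh⟩, ⟨σ, hσ⟩⟩, hhσ⟩ := hF.surjective ρ⁻¹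
    refine ⟨(σ, t), Finset.mem_product.2 ⟨hσ, Finset.mem_univ t⟩, ?_⟩
    have h1 : (fun r => Ψ t (s.enum (σ⁻¹ r))) = fun r => φ (h r) := by
      funext r
      have h2 : σ⁻¹ = ρ * h := by
        rw [eq_comm, ← inv_inj, inv_inv, mul_inv_rev, ← hhσ]
        simp
      rw [h2, ← hg (h r)]
      rfl
    dsimp only
    rw [h1]
    exact (mem_stabilizer_iff hφ).1 hh

/-! ### Shapes as multisets of block sizes -/

section Sizes

variable {s}

theorem mem_sizes {a : ℕ} : a ∈ s.sizes ↔ ∃ e, s.len e = a := by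
  simp only [sizes, multiset, Multiset.mem_map, Finset.mem_val, Finset.mem_univ, true_and]
  constructor
  · rintro ⟨b, h⟩
    exact ⟨b.1, h⟩
  · rintro ⟨e, h⟩
    exact ⟨⟨e, ⟨0, s.one_le_mult e⟩⟩, h⟩

theorem count_sizes (e : Fin d) : s.sizes.count (s.len e) = s.mult e := by
  rw [sizes, multiset, Multiset.count_map]
  change (Finset.univ.filter fun b : s.Block => s.len e = s.len b.1).card = _
  rw [Finset.card_filter, Fintype.sum_sigma, Finset.sum_eq_single e]
  · simp
  · intro e' _ he'
    simp [s.strictMono_len.injective.eq_iff, he'.symm]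
  · simp

theorem length_eq_of_sizes_eq {d' : ℕ} {s' : Shape κ d'} (h : s.sizes = s'.sizes) : d = d' := by
  have hc : ∀ {d : ℕ} (s : Shape κ d), s.sizes.toFinset.card = d := by
    intro d s
    have : s.sizes.toFinset = Finset.univ.image s.len := by
      ext a
      simp [mem_sizes]
    rw [this, Finset.card_image_of_injective _ s.strictMono_len.injective]
    simp
  rw [← hc s, h, hc s']

theorem sizes_injective : Function.Injective (sizes : Shape κ d → Multiset ℕ) := by
  intro s s' h
  have hlen : s.len = s'.len := by
    rw [← StrictMono.range_inj s.strictMono_len s'.strictMono_len]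
    ext a
    simp only [Set.mem_range, ← mem_sizes, h]
  refine Shape.ext hlen (funext fun e => ?_)
  rw [← count_sizes, ← count_sizes, h, hlen]

/-- The distinct sizes in increasing order serve as λ, and their multiplicities as μ. -/
theorem exists_sizes_eq {S : Multiset ℕ} (hS : S ≠ 0) (h1 : ∀ a ∈ S, 1 ≤ a) (hκ : ∀ a ∈ S, a ≤ κ)
    (hsum : S.sum ≤ κ + 1) : ∃ d ∈ Finset.Icc 1 (κ + 1), ∃ s : Shape κ d, s.sizes = S := by
  have hmem : ∀ e, S.toFinset.orderEmbOfFin rfl e ∈ S := fun e =>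
    Multiset.mem_toFinset.1 (Finset.orderEmbOfFin_mem _ rfl e)
  have hsum' : ∑ e, S.count (S.toFinset.orderEmbOfFin rfl e) * S.toFinset.orderEmbOfFin rfl e =
      S.sum := by
    rw [Finset.sum_multiset_count, ← Finset.sum_coe_sort S.toFinset]
    exact (S.toFinset.orderIsoOfFin rfl).toEquiv.sum_comp fun a : S.toFinset => S.count a.1 • a.1
  -- Each distinct size contributes at least 1 to the total, which bounds d.
  have hcard : S.toFinset.card ≤ κ + 1 := by
    refine le_trans ?_ ((hsum'.trans_le hsum))
    calc S.toFinset.card = ∑ e : Fin S.toFinset.card, 1 := by simp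
      _ ≤ _ := Finset.sum_le_sum fun e _ =>
        Nat.mul_pos (Multiset.count_pos.2 (hmem e)) (h1 _ (hmem e))
  have hd : 1 ≤ S.toFinset.card := by
    rw [Nat.one_le_iff_ne_zero, Ne, Finset.card_eq_zero, Multiset.toFinset_eq_empty]
    exact hS
  let s : Shape κ S.toFinset.card :=
    { len := S.toFinset.orderEmbOfFin rfl
      mult := fun e => S.count (S.toFinset.orderEmbOfFin rfl e)
      one_le_d := hd
      one_le_len := fun e => h1 _ (hmem e)
      strictMono_len := (S.toFinset.orderEmbOfFin rfl).strictMono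
      len_le := fun e => hκ _ (hmem e)
      one_le_mult := fun e => Multiset.count_pos.2 (hmem e)
      sum_le := hsum'.trans_le hsum }
  refine ⟨_, Finset.mem_Icc.2 ⟨hd, hcard⟩, s, Multiset.ext.2 fun a => ?_⟩
  have hrange : a ∈ S ↔ ∃ e, s.len e = a := by
    rw [← Multiset.mem_toFinset, ← Finset.mem_coe, ← Finset.range_orderEmbOfFin S.toFinset rfl]
    rfl
  by_cases ha : a ∈ S
  · obtain ⟨e, rfl⟩ := hrange.1 ha
    rw [count_sizes]
  · rw [Multiset.count_eq_zero_of_notMem ha, Multiset.count_eq_zero_of_notMem]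
    rwa [mem_sizes, ← hrange]

end Sizes

end Shape

/-- Every family counted on the right has exactly one shape. The weight bound costs nothing:
disjoint blocks in a set of κ + 1 elements have total size at most κ + 1. -/
theorem sum_shapes {M : Type*} [AddCommMonoid M] {κ : ℕ} (p : Finset (Fin (κ + 1)) → Prop)
    [DecidablePred p] (W : Finset (Finset (Fin (κ + 1))) → M) :
    ∑ d ∈ Finset.Icc 1 (κ + 1), ∑ s : Shape κ d,
      ∑ Q ∈ (subpartitions Finset.univ).filter
        (fun Q => p (Q.biUnion id) ∧ Q.val.map Finset.card = s.sizes), W Q =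
      ∑ Q ∈ (subpartitions Finset.univ).filter
        (fun Q => p (Q.biUnion id) ∧ Q ≠ ∅ ∧ ∀ B ∈ Q, B.card ≤ κ), W Q := by
  simp only [Finset.sum_filter]
  have h : ∀ d : ℕ, ∑ s : Shape κ d, ∑ Q ∈ subpartitions (Finset.univ : Finset (Fin (κ + 1))),
      (if p (Q.biUnion id) ∧ Q.val.map Finset.card = s.sizes then W Q else 0) =
      ∑ Q ∈ subpartitions (Finset.univ : Finset (Fin (κ + 1))), ∑ s : Shape κ d,
      (if p (Q.biUnion id) ∧ Q.val.map Finset.card = s.sizes then W Q else 0) :=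
    fun d => Finset.sum_comm
  simp only [h]
  rw [Finset.sum_comm]
  refine Finset.sum_congr rfl fun Q hQ => ?_
  obtain ⟨-, hne, hdisj⟩ := mem_subpartitions.1 hQ
  split_ifs with hcond
  · obtain ⟨hp, hQ0, hQκ⟩ := hcond
    have hsum : (Q.val.map Finset.card).sum ≤ κ + 1 := by
      have h1 : (Q.biUnion id).card = ∑ B ∈ Q, B.card :=
        Finset.card_biUnion fun B hB C hC hBC => Finset.disjoint_left.2 fun a ha ha' =>
          hBC (hdisj B hB C hC a ha ha')
      refine (h1.symm.trans_le (Finset.card_le_univ _)).trans ?_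
      simp
    obtain ⟨d, hd, s, hs⟩ := Shape.exists_sizes_eq (κ := κ) (S := Q.val.map Finset.card)
      (by simpa using hQ0)
      (by
        intro a ha
        obtain ⟨B, hB, rfl⟩ := Multiset.mem_map.1 ha
        exact Finset.card_pos.2 (hne B hB))
      (by
        intro a ha
        obtain ⟨B, hB, rfl⟩ := Multiset.mem_map.1 ha
        exact hQκ B hB) hsum
    rw [Finset.sum_eq_single_of_mem d hd, Finset.sum_eq_single_of_mem s (Finset.mem_univ s),
      if_pos ⟨hp, hs.symm⟩]
    · intro s' _ hs'
      exact if_neg fun h => hs' (Shape.sizes_injective (h.2.symm.trans hs.symm))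
    · intro d' _ hd'
      refine Finset.sum_eq_zero fun s' _ => if_neg fun h => hd' ?_
      exact Shape.length_eq_of_sizes_eq (h.2.symm.trans hs.symm)
  · refine Finset.sum_eq_zero fun d _ => Finset.sum_eq_zero fun s _ => if_neg fun h =>
      hcond ⟨h.1, ?_, ?_⟩
    · rintro rfl
      have h0 : s.len ⟨0, s.one_le_d⟩ ∈ s.sizes := Shape.mem_sizes.2 ⟨_, rfl⟩
      rw [← h.2] at h0
      simp at h0
    · intro B hB
      have hB' : B.card ∈ s.sizes := h.2 ▸ Multiset.mem_map_of_mem Finset.card hB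
      obtain ⟨e, he⟩ := Shape.mem_sizes.1 hB'
      exact he ▸ s.len_le e

/-! ### Shuffles as subsets, with and without the marker -/

namespace Shuffle

variable {p q : ℕ}

/-- The increasing sequence `τ(1), …, τ(q)`. -/
def initial (τ : Shuffle p q) (a : Fin q) : Fin p := τ.perm (Fin.castLE τ.le a)

theorem strictMono_initial (τ : Shuffle p q) : StrictMono τ.initial := fun a b h =>
  τ.head (a := Fin.castLE τ.le a) (b := Fin.castLE τ.le b) a.2 b.2 h

theorem perm_mem_image_initial (τ : Shuffle p q) (a : Fin p) :
    τ.perm a ∈ Finset.univ.image τ.initial ↔ a.val < q := by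
  simp only [Finset.mem_image, Finset.mem_univ, true_and]
  constructor
  · rintro ⟨b, h⟩
    rw [← τ.perm.injective h]
    exact b.2
  · exact fun h => ⟨⟨a, h⟩, rfl⟩

/-- Both monotone stretches of a shuffle are increasing enumerations, of the chosen set and of its
complement. -/
theorem eq_of_image_initial_eq {τ τ' : Shuffle p q}
    (h : Finset.univ.image τ.initial = Finset.univ.image τ'.initial) : τ = τ' := by
  have hhead : τ.initial = τ'.initial := by
    rw [← StrictMono.range_inj τ.strictMono_initial τ'.strictMono_initial]
    simpa using congrArg (fun S : Finset (Fin p) => (S : Set (Fin p))) h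
  have hrange : ∀ τ : Shuffle p q,
      Set.range (fun a : {a : Fin p // q ≤ a.val} => τ.perm a) =
        {b | b ∉ Finset.univ.image τ.initial} := by
    intro τ
    ext b
    obtain ⟨a, rfl⟩ := τ.perm.surjective b
    rw [Set.mem_ofPred_eq, perm_mem_image_initial, not_lt]
    simp
  have hmono : ∀ τ : Shuffle p q,
      StrictMono fun a : {a : Fin p // q ≤ a.val} => τ.perm a := fun τ a b hab =>
    τ.tail a.2 b.2 hab
  have htail := (StrictMono.range_inj (hmono τ) (hmono τ')).1 (by rw [hrange, hrange, h])
  refine Shuffle.ext (Equiv.ext fun a => ?_)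
  by_cases ha : a.val < q
  · exact congrFun hhead ⟨a, ha⟩
  · exact congrFun htail ⟨a, not_lt.1 ha⟩

theorem exists_image_initial_eq {T : Finset (Fin p)} (hT : T.card = q) :
    ∃ τ : Shuffle p q, Finset.univ.image τ.initial = T := by
  have hq : q ≤ p := by
    rw [← hT]
    exact (Finset.card_le_univ T).trans_eq (Fintype.card_fin p)
  have hT' : Tᶜ.card = p - q := by rw [Finset.card_compl, Fintype.card_fin, hT]
  let f : Fin p → Fin p := fun a =>
    if h : a.val < q then T.orderEmbOfFin hT ⟨a, h⟩
    else Tᶜ.orderEmbOfFin hT' ⟨a - q, by omega⟩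
  have hf : ∀ a : Fin p, ∀ h : a.val < q, f a = T.orderEmbOfFin hT ⟨a, h⟩ := fun a h => dif_pos h
  have hf' : ∀ a : Fin p, ∀ h : ¬ a.val < q,
      f a = Tᶜ.orderEmbOfFin hT' ⟨a - q, by omega⟩ := fun a h => dif_neg h
  have hfT : ∀ a : Fin p, f a ∈ T ↔ a.val < q := by
    intro a
    by_cases h : a.val < q
    · rw [hf a h]
      exact iff_of_true (Finset.orderEmbOfFin_mem _ _ _) h
    · rw [hf' a h]
      exact iff_of_false (Finset.mem_compl.1 (Finset.orderEmbOfFin_mem _ _ _)) h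
  have hhead : StrictMonoOn f {a | a.val < q} := by
    intro a ha b hb hab
    rw [hf a ha, hf b hb]
    exact (T.orderEmbOfFin hT).strictMono hab
  have htail : StrictMonoOn f {a | q ≤ a.val} := by
    intro a ha b hb hab
    rw [hf' a (not_lt.2 ha), hf' b (not_lt.2 hb)]
    refine (Tᶜ.orderEmbOfFin hT').strictMono (Fin.mk_lt_mk.2 ?_)
    exact Nat.sub_lt_sub_right ha hab
  have hinj : Function.Injective f := by
    intro a b hab
    have hiff : a.val < q ↔ b.val < q := by rw [← hfT, ← hfT, hab]
    by_cases h : a.val < q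
    · exact hhead.injOn h (hiff.1 h) hab
    · exact htail.injOn (not_lt.1 h) (not_lt.1 (mt hiff.2 h)) hab
  let τ : Shuffle p q :=
    { perm := Equiv.ofBijective f (Finite.injective_iff_bijective.1 hinj)
      le := hq
      head := hhead
      tail := htail }
  refine ⟨τ, Finset.ext fun b => ?_⟩
  obtain ⟨a, rfl⟩ := τ.perm.surjective b
  rw [perm_mem_image_initial]
  exact (hfT a).symm

theorem coe_rest (τ : Shuffle p q) {α : Type*} (i : Fin p → α) :
    (τ.rest i : Multiset α) = (Finset.univ \ Finset.univ.image τ.initial).val.map i := by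
  have h : Finset.univ \ Finset.univ.image τ.initial =
      (Finset.univ.filter fun a : Fin p => q ≤ a.val).map τ.perm.toEmbedding := by
    ext b
    obtain ⟨a, rfl⟩ := τ.perm.surjective b
    rw [Finset.mem_sdiff, perm_mem_image_initial]
    simp
  rw [h, Finset.map_val, Multiset.map_map, rest, ← Multiset.map_coe, ← Multiset.filter_coe]
  rfl

/-- The labels `τ(1), …, τ(q)`, as elements of a set with one additional last element. -/
def withoutLast (τ : Shuffle p q) (a : Fin q) : Fin (p + 1) := (τ.initial a).castSucc

/-- The labels `τ(1), …, τ(q - 1)`, followed by an additional last element. -/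
def withLast (τ : Shuffle p (q - 1)) (a : Fin q) : Fin (p + 1) :=
  if h : a.val < q - 1 then (τ.initial ⟨a, h⟩).castSucc else Fin.last p

theorem image_withoutLast (τ : Shuffle p q) : Finset.univ.image τ.withoutLast =
    (Finset.univ.image τ.initial).map Fin.castSuccEmb := by
  rw [Finset.map_eq_image, Finset.image_image]
  rfl

theorem withoutLast_injective (τ : Shuffle p q) : Function.Injective τ.withoutLast :=
  (Fin.castSucc_injective p).comp τ.strictMono_initial.injective

theorem withLast_of_lt (τ : Shuffle p (q - 1)) {a : Fin q} (h : a.val < q - 1) :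
    τ.withLast a = (τ.initial ⟨a, h⟩).castSucc := dif_pos h

theorem withLast_eq_last (τ : Shuffle p (q - 1)) {a : Fin q} :
    τ.withLast a = Fin.last p ↔ a.val = q - 1 := by
  by_cases h : a.val < q - 1
  · rw [withLast_of_lt τ h]
    exact iff_of_false (Fin.castSucc_lt_last _).ne h.ne
  · rw [withLast, dif_neg h]
    exact iff_of_true rfl (by omega)

theorem image_withLast (hq : 0 < q) (τ : Shuffle p (q - 1)) : Finset.univ.image τ.withLast =
    insert (Fin.last p) ((Finset.univ.image τ.initial).map Fin.castSuccEmb) := by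
  ext b
  simp only [Finset.mem_image, Finset.mem_univ, true_and, Finset.mem_insert, Finset.mem_map,
    exists_exists_eq_and]
  constructor
  · rintro ⟨a, rfl⟩
    by_cases h : a.val < q - 1
    · exact Or.inr ⟨⟨a, h⟩, (withLast_of_lt τ h).symm⟩
    · exact Or.inl ((withLast_eq_last τ).2 (by omega))
  · rintro (rfl | ⟨a, rfl⟩)
    · exact ⟨⟨q - 1, by omega⟩, (withLast_eq_last τ).2 rfl⟩
    · exact ⟨⟨a, by omega⟩, withLast_of_lt τ (a := ⟨a, by omega⟩) a.2⟩

theorem withLast_injective (τ : Shuffle p (q - 1)) : Function.Injective τ.withLast := by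
  intro a b h
  by_cases ha : a.val < q - 1
  · by_cases hb : b.val < q - 1
    · rw [withLast_of_lt τ ha, withLast_of_lt τ hb] at h
      have := τ.strictMono_initial.injective (Fin.castSucc_injective p h)
      exact Fin.ext (Fin.mk.inj this)
    · have := (withLast_eq_last τ).1 (h.trans ((withLast_eq_last τ).2 (by omega)))
      omega
  · have := (withLast_eq_last τ).1 (h.symm.trans ((withLast_eq_last τ).2 (by omega)))
    exact Fin.ext (by omega)

end Shuffle

theorem last_notMem_map_castSuccEmb {p : ℕ} (T : Finset (Fin p)) :
    Fin.last p ∉ T.map Fin.castSuccEmb := by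
  simp [(Fin.castSucc_lt_last _).ne]

theorem exists_eq_map_castSuccEmb {p : ℕ} {T : Finset (Fin (p + 1))} (hT : Fin.last p ∉ T) :
    ∃ T' : Finset (Fin p), T'.map Fin.castSuccEmb = T := by
  refine ⟨Finset.univ.filter fun a => a.castSucc ∈ T, Finset.ext fun b => ?_⟩
  refine Fin.lastCases ?_ (fun a => ?_) b
  · exact iff_of_false (last_notMem_map_castSuccEmb _) hT
  · simp

theorem Shuffle.last_notMem_iff {p q : ℕ} {T : Finset (Fin (p + 1))} (hT : T.card = q) :
    Fin.last p ∉ T ↔ ∃ τ : Shuffle p q, Finset.univ.image τ.withoutLast = T := by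
  constructor
  · intro h
    obtain ⟨T, rfl⟩ := exists_eq_map_castSuccEmb h
    obtain ⟨τ, rfl⟩ := Shuffle.exists_image_initial_eq ((Finset.card_map _).symm.trans hT)
    exact ⟨τ, τ.image_withoutLast⟩
  · rintro ⟨τ, rfl⟩
    rw [Shuffle.image_withoutLast]
    exact last_notMem_map_castSuccEmb _

theorem Shuffle.last_mem_iff {p q : ℕ} (hq : 0 < q) {T : Finset (Fin (p + 1))}
    (hT : T.card = q) :
    Fin.last p ∈ T ↔ ∃ τ : Shuffle p (q - 1), Finset.univ.image τ.withLast = T := by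
  constructor
  · intro h
    obtain ⟨T', hT'⟩ := exists_eq_map_castSuccEmb (Finset.notMem_erase (Fin.last p) T)
    have hcard : T'.card = q - 1 := by
      rw [← hT, ← Finset.card_erase_of_mem h, ← hT', Finset.card_map]
    obtain ⟨τ, hτ⟩ := Shuffle.exists_image_initial_eq hcard
    exact ⟨τ, by rw [Shuffle.image_withLast hq, hτ, hT', Finset.insert_erase h]⟩
  · rintro ⟨τ, rfl⟩
    rw [Shuffle.image_withLast hq]
    exact Finset.mem_insert_self _ _

/-! ### Evaluation of the sums over l and k -/

variable {𝕜 : Type*} [RCLike 𝕜] {n m κ d : ℕ}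

theorem mixedPd_eq_symbolPd {f : Base 𝕜 n m → 𝕜} (hf : ContDiff 𝕜 ∞ f) (xs : List (Fin n))
    (ys : List (Fin m)) (p : Base 𝕜 n m) :
    mixedPd xs ys f p = symbolPd f p
      (((xs : Multiset (Fin n)).map fun a => MvPolynomial.X (Sum.inl a)).prod *
        ((ys : Multiset (Fin m)).map fun l => MvPolynomial.X (Sum.inr l)).prod) := by
  rw [mixedPd, ← symbolPd_prod_X hf]
  simp [Function.comp_def]

theorem kron_eq {q : ℕ} {α : Type*} [DecidableEq α] (k i : Fin q → α) :
    kron 𝕜 k i = if ∀ a, k a = i a then 1 else 0 := by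
  rw [kron, Finset.prod_ite_zero]
  simp

namespace Shape

variable (s : Shape κ d)

theorem nodup_blocks : s.blocks.Nodup := by
  refine List.nodup_flatMap.2 ⟨fun e _ => (List.nodup_finRange _).map fun ν ν' h => by
    simpa using h, ?_⟩
  refine (List.nodup_finRange d).imp fun {e e'} h => ?_
  rw [Function.onFun, List.disjoint_left]
  simp only [List.mem_map, not_exists, not_and]
  rintro _ ⟨ν, -, rfl⟩ ν' - h'
  exact h (congrArg Sigma.fst h').symm

theorem mem_blocks (b : s.Block) : b ∈ s.blocks :=
  List.mem_flatMap.2 ⟨b.1, List.mem_finRange _, List.mem_map.2 ⟨b.2, List.mem_finRange _, rfl⟩⟩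

theorem coe_blocks : (s.blocks : Multiset s.Block) = Finset.univ.val :=
  (Multiset.Nodup.ext (Multiset.coe_nodup.2 s.nodup_blocks) Finset.univ.nodup).2 fun b =>
    iff_of_true (s.mem_blocks b) (Finset.mem_univ b)

theorem coe_blocks_erase (b : s.Block) :
    (s.blocks.erase b : Multiset s.Block) = (Finset.univ.erase b).val := by
  rw [Finset.erase_val, ← coe_blocks, Multiset.coe_erase]

/-- The sum over all families `l` of a product over blocks distributes into a product of sums over a
single index. -/
theorem sum_symbolPd (f : Base 𝕜 n m → 𝕜) (z : Jet 𝕜 n m κ) (v : s.Block → Multiset (Fin n))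
    (P : MvPolynomial (Fin n ⊕ Fin m) 𝕜)
    (w : s.Block → Fin m → MvPolynomial (Fin n ⊕ Fin m) 𝕜) :
    ∑ l : s.Block → Fin m, symbolPd f z.base (P * ∏ b, w b (l b)) * ∏ b, z.ext (l b) (v b) =
      symbolPd f z.base (P * ∏ b, ∑ l, MvPolynomial.C (z.ext l (v b)) * w b l) := by
  rw [Finset.prod_univ_sum, Fintype.piFinset_univ, Finset.mul_sum, map_sum]
  refine Finset.sum_congr rfl fun l _ => ?_
  rw [Finset.prod_mul_distrib, ← map_prod, mul_left_comm, ← MvPolynomial.smul_eq_C_mul, map_smul,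
    smul_eq_mul, mul_comm]

theorem sum_mixedPd {f : Base 𝕜 n m → 𝕜} (hf : ContDiff 𝕜 ∞ f) (xs : List (Fin n))
    (z : Jet 𝕜 n m κ) (v : s.Block → Multiset (Fin n)) :
    ∑ l : s.Block → Fin m,
      mixedPd xs (s.blocks.map l) f z.base * ∏ b, z.ext (l b) (v b) =
      symbolPd f z.base (((xs : Multiset (Fin n)).map fun a => MvPolynomial.X (Sum.inl a)).prod *
        ∏ b, z.symbol (v b)) := by
  simp only [Jet.symbol]
  rw [← sum_symbolPd s f z v _ fun _ l => MvPolynomial.X (Sum.inr l)]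
  refine Finset.sum_congr rfl fun l _ => ?_
  rw [mixedPd_eq_symbolPd hf, ← Multiset.map_coe, coe_blocks, Multiset.map_map]
  rfl

theorem sum_mixedPd_erase {f : Base 𝕜 n m → 𝕜} (hf : ContDiff 𝕜 ∞ f) (xs : List (Fin n))
    (z : Jet 𝕜 n m κ) (v : s.Block → Multiset (Fin n)) (j : Fin m) (b₀ : s.Block) :
    ∑ l : s.Block → Fin m, (if j = l b₀ then 1 else 0) *
      mixedPd xs ((s.blocks.erase b₀).map l) f z.base * ∏ b, z.ext (l b) (v b) =
      z.ext j (v b₀) * symbolPd f z.base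
        (((xs : Multiset (Fin n)).map fun a => MvPolynomial.X (Sum.inl a)).prod *
          ∏ b ∈ Finset.univ.erase b₀, z.symbol (v b)) := by
  set P : MvPolynomial (Fin n ⊕ Fin m) 𝕜 :=
    ((xs : Multiset (Fin n)).map fun a => MvPolynomial.X (Sum.inl a)).prod with hP
  -- The distinguished block carries the scalar δ^j_l instead of ∂/∂y^l, so the dropped derivative
  -- fits the same distributive law.
  let w : s.Block → Fin m → MvPolynomial (Fin n ⊕ Fin m) 𝕜 := fun b l =>
    if b = b₀ then MvPolynomial.C (if j = l then 1 else 0) else MvPolynomial.X (Sum.inr l)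
  have hw₀ : ∀ l, w b₀ l = MvPolynomial.C (if j = l then 1 else 0) := fun l => if_pos rfl
  have hw : ∀ b ∈ Finset.univ.erase b₀, ∀ l, w b l = MvPolynomial.X (Sum.inr l) := fun b hb l =>
    if_neg (Finset.ne_of_mem_erase hb)
  have h1 : ∀ l : s.Block → Fin m, symbolPd f z.base (P * ∏ b, w b (l b)) =
      (if j = l b₀ then 1 else 0) * mixedPd xs ((s.blocks.erase b₀).map l) f z.base := by
    intro l
    rw [mixedPd_eq_symbolPd hf, ← Multiset.map_coe, coe_blocks_erase, Multiset.map_map, ← hP,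
      ← Finset.mul_prod_erase _ _ (Finset.mem_univ b₀), hw₀, mul_left_comm,
      ← MvPolynomial.smul_eq_C_mul, map_smul, smul_eq_mul,
      Finset.prod_congr rfl fun b hb => hw b hb (l b)]
    rfl
  have h2 : ∏ b, ∑ l, MvPolynomial.C (z.ext l (v b)) * w b l =
      MvPolynomial.C (z.ext j (v b₀)) * ∏ b ∈ Finset.univ.erase b₀, z.symbol (v b) := by
    rw [← Finset.mul_prod_erase _ _ (Finset.mem_univ b₀)]
    congr 1
    · rw [Finset.sum_eq_single j]
      · rw [hw₀, if_pos rfl, map_one, mul_one]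
      · intro l _ hl
        rw [hw₀, if_neg hl.symm, map_zero, mul_zero]
      · simp
    · refine Finset.prod_congr rfl fun b hb => ?_
      simp only [hw b hb, Jet.symbol]
  simp only [← h1]
  rw [sum_symbolPd, h2, mul_left_comm, ← MvPolynomial.smul_eq_C_mul, map_smul, smul_eq_mul]

variable {s}

/-- The Kronecker symbol prescribes `k` on every label, so one summand survives. The value of `i'`
at the marker is not used. -/
theorem sum_kron_withoutLast (σ : Equiv.Perm s.Pos) (τ : Shuffle κ s.weight) (i : Fin κ → Fin n)
    (i' : Fin (κ + 1) → Fin n) (hi : ∀ a : Fin κ, i' a.castSucc = i a)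
    (G : (s.Pos → Fin n) → 𝕜) :
    ∑ k : s.Pos → Fin n, kron 𝕜 (fun a : Fin s.weight => k (σ (s.enum.symm a)))
      (fun a : Fin s.weight => i (τ.perm (Fin.castLE τ.le a))) * G k =
      G fun q => i' (τ.withoutLast (s.enum (σ⁻¹ q))) := by
  simp only [kron_eq]
  rw [Finset.sum_eq_single fun q => i' (τ.withoutLast (s.enum (σ⁻¹ q)))]
  · rw [if_pos, one_mul]
    intro a
    beta_reduce
    rw [Equiv.Perm.inv_def, Equiv.symm_apply_apply, Equiv.apply_symm_apply]
    exact hi _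
  · intro k _ hk
    rw [if_neg, zero_mul]
    intro h
    refine hk (funext fun q => ?_)
    have := h (s.enum (σ⁻¹ q))
    rw [Equiv.symm_apply_apply, Equiv.Perm.inv_def, Equiv.apply_symm_apply] at this
    exact this.trans (hi _).symm
  · simp

/-- Here the label σ(last) is unconstrained: its index `k'` stays free and is the component of the
vector field being differentiated. -/
theorem sum_kron_withLast (σ : Equiv.Perm s.Pos) (τ : Shuffle κ (s.weight - 1))
    (i : Fin κ → Fin n) (G : (s.Pos → Fin n) → 𝕜) :
    ∑ k : s.Pos → Fin n, kron 𝕜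
        (fun a : Fin (s.weight - 1) => k (σ (s.enum.symm (Fin.castLE (Nat.sub_le s.weight 1) a))))
        (fun a : Fin (s.weight - 1) => i (τ.perm (Fin.castLE τ.le a))) * G k =
      ∑ k' : Fin n, G fun q =>
        Fin.snoc (α := fun _ => Fin n) i k' (τ.withLast (s.enum (σ⁻¹ q))) := by
  have hlast : τ.withLast (s.enum (σ⁻¹ (σ s.last))) = Fin.last κ := by
    rw [Equiv.Perm.inv_def, Equiv.symm_apply_apply, last, Equiv.apply_symm_apply, Shuffle.withLast_eq_last]
  let g : Fin n → s.Pos → Fin n := fun k' q =>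
    Fin.snoc (α := fun _ => Fin n) i k' (τ.withLast (s.enum (σ⁻¹ q)))
  have hg : ∀ k', g k' (σ s.last) = k' := by
    intro k'
    change Fin.snoc (α := fun _ => Fin n) i k' _ = k'
    rw [hlast, Fin.snoc_last]
  have hg_inj : Set.InjOn g (Finset.univ : Finset (Fin n)) := fun k _ k' _ h => by
    rw [← hg k, h, hg]
  change _ = ∑ k', G (g k')
  rw [← Finset.sum_image (f := G) hg_inj]
  simp only [kron_eq, ite_mul, one_mul, zero_mul]
  rw [← Finset.sum_filter]
  refine Finset.sum_congr (Finset.ext fun k => ?_) fun _ _ => rfl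
  simp only [Finset.mem_filter, Finset.mem_univ, true_and, Finset.mem_image]
  constructor
  · intro h
    refine ⟨k (σ s.last), funext fun q => ?_⟩
    by_cases hq : (s.enum (σ⁻¹ q)).val < s.weight - 1
    · have h1 := h ⟨_, hq⟩
      have h2 : s.enum.symm (Fin.castLE (Nat.sub_le s.weight 1) ⟨(s.enum (σ⁻¹ q)).val, hq⟩) =
          σ⁻¹ q := by
        rw [Equiv.symm_apply_eq]
        rfl
      have h3 : σ (σ⁻¹ q) = q := σ.apply_symm_apply q
      rw [h2, h3] at h1
      rw [h1]
      change Fin.snoc (α := fun _ => Fin n) i _ _ = _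
      rw [Shuffle.withLast_of_lt τ hq, Fin.snoc_castSucc]
      rfl
    · have h2 : q = σ s.last := by
        rw [← Equiv.Perm.inv_eq_iff_eq, last, Equiv.eq_symm_apply]
        refine Fin.ext ?_
        have := (s.enum (σ⁻¹ q)).2
        change _ = s.weight - 1
        omega
      rw [h2, hg]
  · rintro ⟨k', rfl⟩ a
    change Fin.snoc (α := fun _ => Fin n) i _ _ = _
    rw [Equiv.Perm.inv_def, Equiv.symm_apply_apply, Equiv.apply_symm_apply,
      Shuffle.withLast_of_lt τ (a := Fin.castLE (Nat.sub_le s.weight 1) a) a.2, Fin.snoc_castSucc]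
    rfl

section Summands

variable {α : Type*} [DecidableEq α] {φ : s.Pos → α} (hφ : Function.Injective φ)
include hφ

theorem prod_symbol_parts (i : α → Fin n) (z : Jet 𝕜 n m κ) :
    ∏ b, z.symbol (multiset fun γ => i (φ (s.pos b γ))) =
      ∏ B ∈ s.parts φ, z.symbol (B.val.map i) := by
  rw [parts, Finset.prod_image (blockImage_injective hφ).injOn]
  simp only [map_val_blockImage hφ]

theorem filter_notMem_parts (p : s.Pos) : (s.parts φ).filter (fun B => φ p ∉ B) =
    (Finset.univ.erase (s.toBlock p)).image (s.blockImage φ) := by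
  ext B
  simp only [Finset.mem_filter, mem_parts, Finset.mem_image, Finset.mem_erase, Finset.mem_univ,
    and_true]
  constructor
  · rintro ⟨⟨b, rfl⟩, h⟩
    exact ⟨b, fun hb => h ((apply_mem_blockImage hφ).2 hb.symm), rfl⟩
  · rintro ⟨b, hb, rfl⟩
    exact ⟨⟨b, rfl⟩, fun h => hb ((apply_mem_blockImage hφ).1 h).symm⟩

theorem biUnion_filter_mem_parts (p : s.Pos) :
    ((s.parts φ).filter (fun B => φ p ∈ B)).biUnion id = s.blockImage φ (s.toBlock p) := by
  have : (s.parts φ).filter (fun B => φ p ∈ B) = {s.blockImage φ (s.toBlock p)} := by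
    ext B
    simp only [Finset.mem_filter, mem_parts, Finset.mem_singleton]
    constructor
    · rintro ⟨⟨b, rfl⟩, h⟩
      rw [(apply_mem_blockImage hφ).1 h]
    · rintro rfl
      exact ⟨⟨_, rfl⟩, (apply_mem_blockImage hφ).2 rfl⟩
  rw [this, Finset.singleton_biUnion, id]

end Summands

end Shape

/-! ### Matching the summands with marked and unmarked families -/

/-- The block containing the last element, with this element removed. -/
def markedBlock (Q : Finset (Finset (Fin (κ + 1)))) : Finset (Fin (κ + 1)) :=
  ((Q.filter fun B => Fin.last κ ∈ B).biUnion id).erase (Fin.last κ)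

/-- The blocks not containing the last element. -/
def unmarkedBlocks (Q : Finset (Finset (Fin (κ + 1)))) : Finset (Finset (Fin (κ + 1))) :=
  Q.filter fun B => Fin.last κ ∉ B

/-- The contribution to the prolongation of a partition with the blocks `U ∪ {last}` and `B ∈ Q`,
where the last element is a marker and the other ones stand for the indices `i`. -/
def markedTerm (X : Fin n → Base 𝕜 n m → 𝕜) (j : Fin m) (i : Fin (κ + 1) → Fin n)
    (z : Jet 𝕜 n m κ) (U : Finset (Fin (κ + 1))) (Q : Finset (Finset (Fin (κ + 1)))) : 𝕜 :=
  ∑ k, z.ext j (k ::ₘ U.val.map i) *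
    partitionTerm (X k) i (Finset.univ.image Fin.castSucc \ U) Q z

theorem image_comp_univ {α β γ : Type*} [Fintype α] [Fintype β] [DecidableEq γ] (f : β → γ)
    {g : α → β} (hg : Function.Surjective g) :
    (Finset.univ.image fun a => f (g a)) = Finset.univ.image f := by
  classical
  rw [← Finset.image_univ_of_surjective hg, Finset.image_image]
  rfl

theorem prod_map_sdiff {β R : Type*} [CommMonoid R] {i : Fin κ → β} {i' : Fin (κ + 1) → β}
    (hi : ∀ a : Fin κ, i' a.castSucc = i a) {T : Finset (Fin κ)} {U : Finset (Fin (κ + 1))}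
    (hU : ∀ a : Fin κ, a.castSucc ∈ U ↔ a ∈ T) (g : β → R) :
    (((Finset.univ \ T).val.map i).map g).prod =
      ∏ a ∈ Finset.univ.image Fin.castSucc \ U, g (i' a) := by
  have h : Finset.univ.image Fin.castSucc \ U = (Finset.univ \ T).map Fin.castSuccEmb := by
    ext b
    refine Fin.lastCases ?_ (fun a => ?_) b
    · simp [(Fin.castSucc_lt_last _).ne]
    · simp [hU]
  rw [h, Finset.prod_map, Multiset.map_map]
  simp only [Fin.coe_castSuccEmb, hi]
  rfl

theorem sum_unmarked {s : Shape κ d} {f : Base 𝕜 n m → 𝕜} (hf : ContDiff 𝕜 ∞ f)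
    {i : Fin κ → Fin n} {i' : Fin (κ + 1) → Fin n} (hi : ∀ a : Fin κ, i' a.castSucc = i a)
    (σ : Equiv.Perm s.Pos) (τ : Shuffle κ s.weight) (z : Jet 𝕜 n m κ) :
    ∑ l : s.Block → Fin m, ∑ k : s.Pos → Fin n,
      kron 𝕜 (fun a : Fin s.weight => k (σ (s.enum.symm a)))
          (fun a : Fin s.weight => i (τ.perm (Fin.castLE τ.le a))) *
        mixedPd (τ.rest i) (s.blocks.map l) f z.base *
      ∏ b : s.Block, z.y (l b) (fun γ : Fin (s.len b.1) => k (s.pos b γ))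
        ((Fintype.card_fin (s.len b.1)).trans_le (s.len_le b.1)) =
      partitionTerm f i' (Finset.univ.image Fin.castSucc)
        (s.parts fun q => τ.withoutLast (s.enum (σ⁻¹ q))) z := by
  have hφ : Function.Injective fun q => τ.withoutLast (s.enum (σ⁻¹ q)) :=
    τ.withoutLast_injective.comp (s.enum.injective.comp (σ⁻¹).injective)
  have hU : ∀ a : Fin κ, a.castSucc ∈
      (s.parts fun q => τ.withoutLast (s.enum (σ⁻¹ q))).biUnion id ↔
        a ∈ Finset.univ.image τ.initial := by
    intro a
    rw [Shape.biUnion_parts]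
    have : (Finset.univ.image fun q => τ.withoutLast (s.enum (σ⁻¹ q))) =
        Finset.univ.image τ.withoutLast :=
      image_comp_univ _ (s.enum.surjective.comp (σ⁻¹).surjective)
    rw [this, Shuffle.image_withoutLast, ← Fin.coe_castSuccEmb,
      Finset.mem_map' Fin.castSuccEmb]
  simp only [mul_assoc, Jet.y_eq_ext]
  rw [Finset.sum_congr rfl fun l _ => Shape.sum_kron_withoutLast σ τ i i' hi _,
    Shape.sum_mixedPd s hf, partitionTerm, Shape.prod_symbol_parts hφ, Shuffle.coe_rest,
    prod_map_sdiff hi hU]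

/-- The label σ(last) is sent to the marker. Its block, carrying δ^j, becomes y^j_{k,U} with the
marker replaced by the free index `k`; the other blocks differentiate X^k. -/
theorem sum_marked {s : Shape κ d} {X : Fin n → Base 𝕜 n m → 𝕜} (hX : ∀ k, ContDiff 𝕜 ∞ (X k))
    (j : Fin m) {i : Fin κ → Fin n} {i' : Fin (κ + 1) → Fin n}
    (hi : ∀ a : Fin κ, i' a.castSucc = i a)
    (σ : Equiv.Perm s.Pos) (τ : Shuffle κ (s.weight - 1)) (z : Jet 𝕜 n m κ) :
    ∑ l : s.Block → Fin m, ∑ k : s.Pos → Fin n,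
      kron 𝕜
          (fun a : Fin (s.weight - 1) =>
            k (σ (s.enum.symm (Fin.castLE (Nat.sub_le s.weight 1) a))))
          (fun a : Fin (s.weight - 1) => i (τ.perm (Fin.castLE τ.le a))) *
        (if j = l (s.toBlock (σ s.last)) then 1 else 0) *
        mixedPd (τ.rest i) ((s.blocks.erase (s.toBlock (σ s.last))).map l)
          (X (k (σ s.last))) z.base *
      ∏ b : s.Block, z.y (l b) (fun γ : Fin (s.len b.1) => k (s.pos b γ))
        ((Fintype.card_fin (s.len b.1)).trans_le (s.len_le b.1)) =
      markedTerm X j i' z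
        (markedBlock (s.parts fun q => τ.withLast (s.enum (σ⁻¹ q))))
        (unmarkedBlocks (s.parts fun q => τ.withLast (s.enum (σ⁻¹ q)))) := by
  set φ : s.Pos → Fin (κ + 1) := fun q => τ.withLast (s.enum (σ⁻¹ q)) with hφ_def
  have hφ : Function.Injective φ :=
    τ.withLast_injective.comp (s.enum.injective.comp (σ⁻¹).injective)
  have hlast : φ (σ s.last) = Fin.last κ := by
    rw [hφ_def]
    beta_reduce
    rw [Equiv.Perm.inv_def, Equiv.symm_apply_apply, Shape.last, Equiv.apply_symm_apply,
      Shuffle.withLast_eq_last]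
  have hmarked : markedBlock (s.parts φ) =
      (s.blockImage φ (s.toBlock (σ s.last))).erase (Fin.last κ) := by
    rw [markedBlock, ← hlast, Shape.biUnion_filter_mem_parts hφ]
  have hunmarked : unmarkedBlocks (s.parts φ) =
      (Finset.univ.erase (s.toBlock (σ s.last))).image (s.blockImage φ) := by
    rw [unmarkedBlocks, ← hlast, Shape.filter_notMem_parts hφ]
  have hU : ∀ a : Fin κ, a.castSucc ∈
      markedBlock (s.parts φ) ∪ (unmarkedBlocks (s.parts φ)).biUnion id ↔
        a ∈ Finset.univ.image τ.initial := by
    intro a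
    have h1 : a.castSucc ∈ markedBlock (s.parts φ) ∪ (unmarkedBlocks (s.parts φ)).biUnion id ↔
        a.castSucc ∈ (s.parts φ).biUnion id := by
      simp only [markedBlock, unmarkedBlocks, Finset.mem_union, Finset.mem_erase,
        Finset.mem_biUnion, Finset.mem_filter, id, ne_eq, (Fin.castSucc_lt_last a).ne,
        not_false_eq_true, true_and]
      grind
    have h2 : Finset.univ.image φ = Finset.univ.image τ.withLast :=
      image_comp_univ _ (s.enum.surjective.comp (σ⁻¹).surjective)
    rw [h1, Shape.biUnion_parts, h2, Shuffle.image_withLast s.weight_pos, Finset.mem_insert,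
      or_iff_right (Fin.castSucc_lt_last a).ne, ← Fin.coe_castSuccEmb,
      Finset.mem_map' Fin.castSuccEmb]
  have hmap : ∀ (k : Fin n) (B : Finset (Fin (κ + 1))), Fin.last κ ∉ B →
      B.val.map (Fin.snoc (α := fun _ => Fin n) i k) = B.val.map i' := by
    intro k B hB
    refine Multiset.map_congr rfl fun a ha => ?_
    obtain ⟨c, rfl⟩ := Fin.exists_castSucc_eq.2 (fun h : a = Fin.last κ => hB (h ▸ ha))
    rw [hi, Fin.snoc_castSucc]
  simp only [mul_assoc, Jet.y_eq_ext]
  rw [Finset.sum_congr rfl fun l _ => Shape.sum_kron_withLast σ τ i _, Finset.sum_comm,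
    markedTerm]
  refine Finset.sum_congr rfl fun k _ => ?_
  have hk : Fin.snoc (α := fun _ => Fin n) i k (τ.withLast (s.enum (σ⁻¹ (σ s.last)))) = k := by
    have := hlast
    rw [hφ_def] at this
    beta_reduce at this
    rw [this, Fin.snoc_last]
  simp only [hk, ← mul_assoc]
  rw [Shape.sum_mixedPd_erase s (hX k), partitionTerm, sdiff_sdiff_left, Finset.sup_eq_union,
    Shuffle.coe_rest, prod_map_sdiff hi hU]
  have hv : ∀ b, (multiset fun γ => Fin.snoc (α := fun _ => Fin n) i k
      (τ.withLast (s.enum (σ⁻¹ (s.pos b γ))))) =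
      (s.blockImage φ b).val.map (Fin.snoc (α := fun _ => Fin n) i k) := fun b =>
    (Shape.map_val_blockImage hφ _ b).symm
  simp only [hv]
  congr 2
  · have hmem : Fin.last κ ∈ s.blockImage φ (s.toBlock (σ s.last)) := by
      rw [← hlast]
      exact (Shape.apply_mem_blockImage hφ).2 rfl
    rw [hmarked, ← hmap k _ (Finset.notMem_erase _ _)]
    conv_lhs => rw [← Finset.insert_erase hmem,
      Finset.insert_val_of_notMem (Finset.notMem_erase _ _), Multiset.map_cons, Fin.snoc_last]
  · congr 1
    rw [hunmarked, Finset.prod_image (Shape.blockImage_injective hφ).injOn]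
    refine Finset.prod_congr rfl fun b hb => ?_
    rw [hmap k]
    rw [← hlast, Shape.apply_mem_blockImage hφ]
    exact (Finset.ne_of_mem_erase hb).symm

/-- The empty family is the pure x-derivative. For the others the bound κ on block sizes is
automatic and is imposed only to agree with `sum_shapes`. -/
theorem sum_unmarked_partitions {f : Base 𝕜 n m → 𝕜} (hf : ContDiff 𝕜 ∞ f)
    {i : Fin κ → Fin n} {i' : Fin (κ + 1) → Fin n} (hi : ∀ a : Fin κ, i' a.castSucc = i a)
    (z : Jet 𝕜 n m κ) :
    iterTotalDeriv f i' (Finset.univ.image Fin.castSucc) z =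
      mixedPd (List.ofFn i) [] f z.base +
      ∑ Q ∈ (subpartitions Finset.univ).filter
        (fun Q => Fin.last κ ∉ Q.biUnion id ∧ Q ≠ ∅ ∧ ∀ B ∈ Q, B.card ≤ κ),
        partitionTerm f i' (Finset.univ.image Fin.castSucc) Q z := by
  have hempty : partitionTerm f i' (Finset.univ.image Fin.castSucc) ∅ z =
      mixedPd (List.ofFn i) [] f z.base := by
    have h := prod_map_sdiff hi (T := ∅) (U := ∅) (by simp)
      fun a => (MvPolynomial.X (Sum.inl a) : MvPolynomial (Fin n ⊕ Fin m) 𝕜)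
    rw [Finset.sdiff_empty] at h
    rw [mixedPd_eq_symbolPd hf, partitionTerm, ← Fin.univ_val_map, h]
    simp
  have hcard : (Finset.univ.image (Fin.castSucc : Fin κ → Fin (κ + 1))).card = κ := by
    rw [Finset.card_image_of_injective _ (Fin.castSucc_injective κ)]
    simp
  have hmem : (∅ : Finset (Finset (Fin (κ + 1)))) ∈
      subpartitions (Finset.univ.image (Fin.castSucc : Fin κ → Fin (κ + 1))) :=
    mem_subpartitions.2 (by simp)
  rw [iterTotalDeriv, ← Finset.add_sum_erase _ _ hmem, hempty]
  congr 1
  refine Finset.sum_congr (Finset.ext fun Q => ?_) fun _ _ => rfl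
  have hsub : ∀ B : Finset (Fin (κ + 1)), B ⊆ Finset.univ.image Fin.castSucc ↔
      Fin.last κ ∉ B := by
    intro B
    constructor
    · intro h hB
      obtain ⟨a, -, ha⟩ := Finset.mem_image.1 (h hB)
      exact (Fin.castSucc_lt_last a).ne ha
    · intro h a ha
      obtain ⟨c, rfl⟩ := Fin.exists_castSucc_eq.2 (fun h' : a = Fin.last κ => h (h' ▸ ha))
      exact Finset.mem_image_of_mem _ (Finset.mem_univ c)
  simp only [Finset.mem_erase, Finset.mem_filter, mem_subpartitions, hsub, Finset.mem_biUnion, id,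
    not_exists, not_and, Finset.subset_univ, implies_true, true_and]
  constructor
  · rintro ⟨h1, h2, h3⟩
    refine ⟨h3, h2, h1, fun B hB => ?_⟩
    exact (Finset.card_le_card ((hsub B).2 (h2 B hB))).trans_eq hcard
  · rintro ⟨h1, h2, h3, -⟩
    exact ⟨h3, h2, h1⟩

/-- A pair of a proper subset U and a family in its complement is the same as a family whose marked
block is U plus the marker. -/
theorem sum_marked_partitions (X : Fin n → Base 𝕜 n m → 𝕜) (j : Fin m)
    (i : Fin (κ + 1) → Fin n) (z : Jet 𝕜 n m κ) :
    ∑ U ∈ (Finset.univ.image Fin.castSucc).ssubsets, ∑ k,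
      z.ext j (k ::ₘ U.val.map i) *
        iterTotalDeriv (X k) i (Finset.univ.image Fin.castSucc \ U) z =
      ∑ Q ∈ (subpartitions Finset.univ).filter
        (fun Q => Fin.last κ ∈ Q.biUnion id ∧ Q ≠ ∅ ∧ ∀ B ∈ Q, B.card ≤ κ),
        markedTerm X j i z (markedBlock Q) (unmarkedBlocks Q) := by
  set J : Finset (Fin (κ + 1)) := Finset.univ.image Fin.castSucc with hJ
  have hcard : J.card = κ := by
    rw [hJ, Finset.card_image_of_injective _ (Fin.castSucc_injective κ)]
    simp
  have hlast : ∀ a, a ∈ J ↔ a ≠ Fin.last κ := by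
    intro a
    rw [← Fin.exists_castSucc_eq, hJ, Finset.mem_image]
    simp only [Finset.mem_univ, true_and]
  have hexpand : ∀ U : Finset (Fin (κ + 1)), ∑ k, z.ext j (k ::ₘ U.val.map i) *
      iterTotalDeriv (X k) i (J \ U) z =
      ∑ Q ∈ subpartitions (J \ U), markedTerm X j i z U Q := by
    intro U
    simp only [iterTotalDeriv, markedTerm, Finset.mul_sum]
    exact Finset.sum_comm
  simp only [hexpand]
  rw [Finset.sum_sigma']
  have hback : ∀ (U : Finset (Fin (κ + 1))) (Q : Finset (Finset (Fin (κ + 1)))),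
      U ∈ J.ssubsets → Q ∈ subpartitions (J \ U) →
        markedBlock (insert (insert (Fin.last κ) U) Q) = U ∧
        unmarkedBlocks (insert (insert (Fin.last κ) U) Q) = Q := by
    intro U Q hU hQ
    have hU' : Fin.last κ ∉ U := fun h => (hlast _).1 ((Finset.mem_ssubsets.1 hU).1 h) rfl
    have hQ' : ∀ B ∈ Q, Fin.last κ ∉ B := fun B hB h =>
      (hlast _).1 (Finset.mem_sdiff.1 ((mem_subpartitions.1 hQ).1 B hB h)).1 rfl
    constructor
    · rw [markedBlock, Finset.filter_insert, if_pos (Finset.mem_insert_self _ _),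
        Finset.filter_false_of_mem hQ', insert_empty_eq, Finset.singleton_biUnion, id,
        Finset.erase_insert hU']
    · rw [unmarkedBlocks, Finset.filter_insert,
        if_neg (not_not.2 (Finset.mem_insert_self _ _)), Finset.filter_true_of_mem hQ']
  refine Finset.sum_bij' (fun q _ => insert (insert (Fin.last κ) q.1) q.2)
    (fun Q _ => ⟨markedBlock Q, unmarkedBlocks Q⟩) ?_ ?_ ?_ ?_ ?_
  · rintro ⟨U, Q⟩ h
    obtain ⟨hU, hQ⟩ := Finset.mem_sigma.1 h
    dsimp only at hU hQ ⊢
    have hU' := Finset.mem_ssubsets.1 hU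
    obtain ⟨h1, h2, h3⟩ := mem_subpartitions.1 hQ
    have hdisj : ∀ B ∈ Q, ∀ a ∈ B, a ∉ insert (Fin.last κ) U := by
      intro B hB a ha ha'
      obtain ⟨haJ, haU⟩ := Finset.mem_sdiff.1 (h1 B hB ha)
      rcases Finset.mem_insert.1 ha' with h | h
      · exact (hlast a).1 haJ h
      · exact haU h
    refine Finset.mem_filter.2 ⟨mem_subpartitions.2 ⟨fun B _ => Finset.subset_univ B, ?_, ?_⟩,
      ?_, Finset.insert_ne_empty _ _, ?_⟩
    · intro B hB
      rcases Finset.mem_insert.1 hB with rfl | hB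
      · exact Finset.insert_nonempty _ _
      · exact h2 B hB
    · intro B hB C hC a haB haC
      rcases Finset.mem_insert.1 hB with rfl | hB <;> rcases Finset.mem_insert.1 hC with rfl | hC
      · rfl
      · exact absurd haB (hdisj C hC a haC)
      · exact absurd haC (hdisj B hB a haB)
      · exact h3 B hB C hC a haB haC
    · exact Finset.mem_biUnion.2 ⟨_, Finset.mem_insert_self _ _, Finset.mem_insert_self _ _⟩
    · intro B hB
      rcases Finset.mem_insert.1 hB with rfl | hB
      · refine (Finset.card_insert_le _ _).trans ?_
        exact (Finset.card_lt_card hU').trans_eq hcard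
      · exact (Finset.card_le_card ((h1 B hB).trans Finset.sdiff_subset)).trans_eq hcard
  · intro Q hQ
    obtain ⟨hQ, hQlast, -, hQcard⟩ := Finset.mem_filter.1 hQ
    obtain ⟨-, h2, h3⟩ := mem_subpartitions.1 hQ
    obtain ⟨B₀, hB₀, hlast₀⟩ := Finset.mem_biUnion.1 hQlast
    have hmarked : markedBlock Q = B₀.erase (Fin.last κ) := by
      rw [markedBlock]
      congr 1
      ext a
      simp only [Finset.mem_biUnion, Finset.mem_filter, id]
      constructor
      · rintro ⟨B, ⟨hB, hBlast⟩, ha⟩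
        rwa [h3 B₀ hB₀ B hB _ hlast₀ hBlast]
      · exact fun ha => ⟨B₀, ⟨hB₀, hlast₀⟩, ha⟩
    refine Finset.mem_sigma.2 ⟨Finset.mem_ssubsets.2 ?_, mem_subpartitions.2 ⟨?_, ?_, ?_⟩⟩
    · dsimp only
      rw [hmarked]
      refine (Finset.ssubset_iff_subset_ne).2 ⟨fun a ha =>
        (hlast a).2 (Finset.ne_of_mem_erase ha), fun h => ?_⟩
      -- If U were everything, its marked block would have κ + 1 elements, against the size bound.
      have h4 := Finset.card_erase_of_mem (s := B₀) hlast₀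
      rw [h, hcard] at h4
      have h5 := hQcard B₀ hB₀
      have h6 := Finset.card_pos.2 (h2 B₀ hB₀)
      omega
    · intro B hB a ha
      obtain ⟨hB, hB'⟩ := Finset.mem_filter.1 hB
      refine Finset.mem_sdiff.2 ⟨(hlast a).2 fun h => hB' (h ▸ ha), ?_⟩
      dsimp only
      rw [hmarked]
      intro ha'
      exact hB' (h3 B₀ hB₀ B hB a (Finset.mem_of_mem_erase ha') ha ▸ hlast₀)
    · exact fun B hB => h2 B (Finset.mem_filter.1 hB).1
    · exact fun B hB C hC => h3 B (Finset.mem_filter.1 hB).1 C (Finset.mem_filter.1 hC).1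
  · rintro ⟨U, Q⟩ h
    obtain ⟨hU, hQ⟩ := Finset.mem_sigma.1 h
    dsimp only at hU hQ ⊢
    rw [(hback U Q hU hQ).1, (hback U Q hU hQ).2]
  · intro Q hQ
    obtain ⟨hQ, hQlast, -, hQcard⟩ := Finset.mem_filter.1 hQ
    obtain ⟨-, h2, h3⟩ := mem_subpartitions.1 hQ
    obtain ⟨B₀, hB₀, hlast₀⟩ := Finset.mem_biUnion.1 hQlast
    have hfilter : Q.filter (fun B => Fin.last κ ∈ B) = {B₀} := by
      ext B
      simp only [Finset.mem_filter, Finset.mem_singleton]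
      constructor
      · rintro ⟨hB, hBlast⟩
        exact h3 B hB B₀ hB₀ _ hBlast hlast₀
      · rintro rfl
        exact ⟨hB₀, hlast₀⟩
    rw [id] at hlast₀
    dsimp only
    rw [markedBlock, unmarkedBlocks, hfilter, Finset.singleton_biUnion, id,
      Finset.insert_erase hlast₀, Finset.insert_eq, ← hfilter, Finset.filter_union_filter_not_eq]
  · rintro ⟨U, Q⟩ h
    obtain ⟨hU, hQ⟩ := Finset.mem_sigma.1 h
    dsimp only at hU hQ ⊢
    rw [(hback U Q hU hQ).1, (hback U Q hU hQ).2]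

end

end LieProlongation

theorem theorem5p12 {𝕜 : Type*} [RCLike 𝕜] {n m : ℕ}
    (X : Fin n → Base 𝕜 n m → 𝕜) (Y : Fin m → Base 𝕜 n m → 𝕜)
    (hX : ∀ k, ContDiff 𝕜 ∞ (X k)) (hY : ∀ j, ContDiff 𝕜 ∞ (Y j))
    (j : Fin m) (κ : ℕ) (hκ : 1 ≤ κ) (i : Fin κ → Fin n)
    -- `F d s` is an arbitrary system of representatives `σ` of the classes `H σ` of permutations
    -- of the labels modulo the stabilizer `H` of the jet monomial of shape `s`
    (F : (d : ℕ) → (s : Shape κ d) → Finset (Equiv.Perm s.Pos))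
    (hF : ∀ (d : ℕ) (s : Shape κ d),
      Subgroup.IsComplement (s.stabilizer : Set (Equiv.Perm s.Pos))
        (F d s : Set (Equiv.Perm s.Pos)))
    (z : Jet 𝕜 n m κ) :
    prolongCoeff X Y j κ i z =
      mixedPd (List.ofFn i) [] (Y j) z.base +
      ∑ d ∈ Finset.Icc 1 (κ + 1), ∑ s : Shape κ d,
        ∑ l : s.Block → Fin m, ∑ k : s.Pos → Fin n,
          ((∑ σ ∈ F d s, ∑ τ : Shuffle κ s.weight,
              kron 𝕜 (fun a : Fin s.weight => k (σ (s.enum.symm a)))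
                  (fun a : Fin s.weight => i (τ.perm (Fin.castLE τ.le a))) *
                mixedPd (τ.rest i) (s.blocks.map l) (Y j) z.base) -
            ∑ σ ∈ F d s, ∑ τ : Shuffle κ (s.weight - 1),
              kron 𝕜
                  (fun a : Fin (s.weight - 1) =>
                    k (σ (s.enum.symm (Fin.castLE (Nat.sub_le s.weight 1) a))))
                  (fun a : Fin (s.weight - 1) => i (τ.perm (Fin.castLE τ.le a))) *
                (if j = l (s.toBlock (σ s.last)) then 1 else 0) *
                mixedPd (τ.rest i) ((s.blocks.erase (s.toBlock (σ s.last))).map l)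
                  (X (k (σ s.last))) z.base) *
          ∏ b : s.Block,
            z.y (l b) (fun γ : Fin (s.len b.1) => k (s.pos b γ))
              ((Fintype.card_fin (s.len b.1)).trans_le (s.len_le b.1)) := by
  -- An index exists because κ ≥ 1. It serves as a dummy value at the marker, which no term reads:
  -- the marker is removed from its block before indices are taken.
  have hn : 0 < n := Fin.pos_iff_nonempty.2 ⟨i ⟨0, hκ⟩⟩
  let i' : Fin (κ + 1) → Fin n := Fin.snoc (α := fun _ => Fin n) i ⟨0, hn⟩
  have hi : ∀ a : Fin κ, i' a.castSucc = i a := fun a => Fin.snoc_castSucc _ _ _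
  have hcoeff := prolongCoeff_eq hX hY j i' (Fin.castSucc_injective κ) z
  simp only [hi] at hcoeff
  rw [hcoeff, sum_unmarked_partitions (hY j) hi, sum_marked_partitions, add_sub_assoc]
  congr 1
  rw [← sum_shapes (fun T => Fin.last κ ∉ T), ← sum_shapes (fun T => Fin.last κ ∈ T),
    ← Finset.sum_sub_distrib]
  refine Finset.sum_congr rfl fun d _ => ?_
  rw [← Finset.sum_sub_distrib]
  refine Finset.sum_congr rfl fun s _ => ?_
  -- Supports avoiding the marker are enumerated by shuffles of weight N, supports containing it by
  -- shuffles of weight N − 1. For N = κ + 1 there are none of the former kind.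
  rw [← Shape.sum_representatives (hF d s) Shuffle.withoutLast_injective
      (fun τ τ' h => Shuffle.eq_of_image_initial_eq (Finset.map_injective _
        (by rwa [Shuffle.image_withoutLast, Shuffle.image_withoutLast] at h)))
      (fun T hT => Shuffle.last_notMem_iff hT),
    ← Shape.sum_representatives (hF d s) Shuffle.withLast_injective
      (fun τ τ' h => Shuffle.eq_of_image_initial_eq (Finset.map_injective Fin.castSuccEmb (by
        rw [Shuffle.image_withLast s.weight_pos, Shuffle.image_withLast s.weight_pos] at h
        rw [← Finset.erase_insert (last_notMem_map_castSuccEmb _), h,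
          Finset.erase_insert (last_notMem_map_castSuccEmb _)])))
      (fun T hT => Shuffle.last_mem_iff s.weight_pos hT)]
  simp only [sub_mul, Finset.sum_sub_distrib, Finset.sum_mul]
  symm
  congr 1
  · refine ((Finset.sum_congr rfl fun l _ => Finset.sum_comm).trans Finset.sum_comm).trans
      (Finset.sum_congr rfl fun σ _ => ?_)
    refine ((Finset.sum_congr rfl fun l _ => Finset.sum_comm).trans Finset.sum_comm).trans
      (Finset.sum_congr rfl fun τ _ => ?_)
    exact sum_unmarked (hY j) hi σ τ z
  · refine ((Finset.sum_congr rfl fun l _ => Finset.sum_comm).trans Finset.sum_comm).trans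
      (Finset.sum_congr rfl fun σ _ => ?_)
    refine ((Finset.sum_congr rfl fun l _ => Finset.sum_comm).trans Finset.sum_comm).trans
      (Finset.sum_congr rfl fun τ _ => ?_)
    exact sum_marked hX j hi σ τ z
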